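/- Let $k$ be a field of characteristic zero, let $H$ be a finite-dimensional Hopf algebra over $k$ with coproduct $\Delta(h)=h_{(1)}\otimes h_{(2)}$, counit $\varepsilon$ and antipode $S$, and let $R\subseteq H$ be a Hopf subalgebra (a subalgebra with $\Delta(R)\subseteq R\otimes R$ and $S(R)\subseteq R$). Put $R^+=R\cap\ker\varepsilon$ and $Q=H/R^+H$, with its quotient coalgebra structure and the right $H$-action $\overline{x}\cdot h=\overline{xh}$. Let $Q^{*op}$ be the $k$-dual of $Q$ with the product $(\theta\gamma)(\overline{x})=\theta(\overline{x_{(2)}})\,\gamma(\overline{x_{(1)}})$, and let $H$ act on it by $(h\rightharpoonup\theta)(\overline{x})=\theta(\overline{xh})$. The generalised factorised smash product $Q^{*op}\#_{\overline\psi}H$ is the vector space $Q^{*op}\otimes H$ with the product $$(\theta\# h)(\gamma\# g)=\theta\,(h_{(2)}\rightharpoonup\gamma)\,\#\,h_{(1)}g ,$$ that is, the product determined by $\overline\psi(h\otimes\theta)=(h_{(2)}\rightharpoonup\theta)\otimes h_{(1)}$. It contains $H$ as the subalgebra $\varepsilon\# H$, where $\varepsilon$ denotes the unit of $Q^{*op}$.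 Two $X$-$Y$-bimodules $V,W$ are called similar, $V\sim W$, if $V$ is isomorphic to a direct summand of $W^{p}$ and $W$ to a direct summand of $V^{q}$ for some integers $p,q\ge 0$. For an extension $B\subseteq A$ of $k$-algebras let $A^{\otimes_B(n)}=A\otimes_B\cdots\otimes_B A$ ($n$ factors) for $n\geq1$, and $A^{\otimes_B(0)}=B$ (as a $B$-$B$-bimodule). The minimum odd depth $d_{odd}(B,A)$ is the least number $2n+1$ with $n\ge 0$ such that $A^{\otimes_B(n)}\sim A^{\otimes_B(n+1)}$ as $B$-$B$-bimodules, and the minimum $H$-depth $d_h(B,A)$ is the least number $2n-1$ with $n\ge 1$ such that $A^{\otimes_B(n)}\sim A^{\otimes_B(n+1)}$ as $A$-$A$-bimodules; each is $\infty$ if there is no such $n$. Then $$d_{odd}\bigl(H,\;Q^{*op}\#_{\overline\psi}H\bigr)=d_h(R,H)$$ as elements of $\mathbb N\cup\{\infty\}$. -/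

import Mathlib

open scoped TensorProduct

universe u

namespace HopfDepth

/-! ### Bimodules over `k`-algebras, and their tensor products over a noncommutative algebra -/

section Bimodules

/-- An `X`-`Y`-bimodule over `k`-algebras `X` and `Y`: a `k`-module with commuting `k`-linear actions
of `X` on the left and of `Y` on the right. -/
structure Bimod (k : Type u) (X : Type u) (Y : Type u) [Field k] [Ring X] [Algebra k X]
    [Ring Y] [Algebra k Y] where
  carrier : Type u
  [addCommGroup : AddCommGroup carrier]
  [module : Module k carrier]
  /-- `lact x m` is `x · m`. -/
  lact : X →ₐ[k] Module.End k carrier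
  /-- `ract (op y) m` is `m · y`. -/
  ract : Yᵐᵒᵖ →ₐ[k] Module.End k carrier
  comm : ∀ x y m, lact x (ract y m) = ract y (lact x m)

attribute [instance] Bimod.addCommGroup Bimod.module

variable {k : Type u} [Field k] {X Y B X' Y' : Type u} [Ring X] [Algebra k X] [Ring Y] [Algebra k Y]
  [Ring B] [Algebra k B] [Ring X'] [Algebra k X'] [Ring Y'] [Algebra k Y']

namespace Bimod

/-- A linear map is a homomorphism of bimodules. -/
def IsHom (M N : Bimod k X Y) (f : M.carrier →ₗ[k] N.carrier) : Prop :=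
  (∀ x m, f (M.lact x m) = N.lact x (f m)) ∧ (∀ y m, f (M.ract y m) = N.ract y (f m))

/-- The direct sum of `p` copies of a bimodule. -/
def power (p : ℕ) (M : Bimod k X Y) : Bimod k X Y where
  carrier := Fin p → M.carrier
  lact := AlgHom.ofLinearMap
    { toFun := fun x => (M.lact x).compLeft (Fin p)
      map_add' := fun x y => by ext; simp
      map_smul' := fun c x => by ext; simp }
    (by ext; simp) (fun x y => by ext; simp)
  ract := AlgHom.ofLinearMap
    { toFun := fun y => (M.ract y).compLeft (Fin p)
      map_add' := fun x y => by ext; simp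
      map_smul' := fun c x => by ext; simp }
    (by ext; simp) (fun x y => by ext; simp)
  comm := fun x y m => by funext i; exact M.comm x y (m i)

/-- `M ∣ p N` for some `p`: there is a split injection of bimodules from `M` into a direct sum of
finitely many copies of `N`. -/
def Divides (M N : Bimod k X Y) : Prop :=
  ∃ (p : ℕ) (i : M.carrier →ₗ[k] (N.power p).carrier) (r : (N.power p).carrier →ₗ[k] M.carrier),
    IsHom M (N.power p) i ∧ IsHom (N.power p) M r ∧ r ∘ₗ i = LinearMap.id

/-- Similarity of bimodules: `M ∣ p N` and `N ∣ q M` for some `p` and `q`. -/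
def Similar (M N : Bimod k X Y) : Prop := Divides M N ∧ Divides N M

/-- Restriction of scalars of a bimodule along algebra homomorphisms on both sides. -/
def restrict (f : X' →ₐ[k] X) (g : Y' →ₐ[k] Y) (M : Bimod k X Y) : Bimod k X' Y' where
  carrier := M.carrier
  lact := M.lact.comp f
  ract := M.ract.comp (AlgHom.op g)
  comm := fun _ _ m => M.comm _ _ m

/-- An algebra as a bimodule over itself by left and right multiplication. -/
def regular (k : Type u) [Field k] (X : Type u) [Ring X] [Algebra k X] : Bimod k X X where
  carrier := X
  lact := Algebra.lmul k X
  ract := AlgHom.ofLinearMap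
    { toFun := fun y => LinearMap.mulRight k y.unop
      map_add' := fun x y => by ext; simp [mul_add]
      map_smul' := fun c x => by ext; simp }
    (by ext; simp) (fun x y => by ext; simp [mul_assoc])
  comm := fun x y m => by simp [mul_assoc]

/-- The relations `(m · b) ⊗ n - m ⊗ (b · n)` that turn `M ⊗[k] N` into `M ⊗_B N`. -/
def balance (M : Bimod k X B) (N : Bimod k B Y) : Submodule k (M.carrier ⊗[k] N.carrier) :=
  Submodule.span k {t | ∃ (m : M.carrier) (b : B) (n : N.carrier),
    t = M.ract (MulOpposite.op b) m ⊗ₜ[k] n - m ⊗ₜ[k] N.lact b n}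

theorem balance_le_left (M : Bimod k X B) (N : Bimod k B Y) (x : X) :
    balance M N ≤ (balance M N).comap ((M.lact x).rTensor N.carrier) := by
  refine Submodule.span_le.2 ?_
  rintro _ ⟨m, b, n, rfl⟩
  exact Submodule.subset_span ⟨M.lact x m, b, n, by simp [M.comm]⟩

theorem balance_le_right (M : Bimod k X B) (N : Bimod k B Y) (y : Yᵐᵒᵖ) :
    balance M N ≤ (balance M N).comap ((N.ract y).lTensor M.carrier) := by
  refine Submodule.span_le.2 ?_
  rintro _ ⟨m, b, n, rfl⟩
  exact Submodule.subset_span ⟨m, b, N.ract y n, by simp [N.comm]⟩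

/-- The left action `x · (m ⊗ n) = (x · m) ⊗ n` on `M ⊗_B N`. -/
def tensorLact (M : Bimod k X B) (N : Bimod k B Y) :
    X →ₐ[k] Module.End k ((M.carrier ⊗[k] N.carrier) ⧸ balance M N) :=
  AlgHom.ofLinearMap
    { toFun := fun x => (balance M N).mapQ (balance M N) _ (balance_le_left M N x)
      map_add' := fun x y => by ext; simp
      map_smul' := fun c x => by
        ext
        simp [← Submodule.Quotient.mk_smul] }
    (by ext; simp) (fun x y => by ext; simp)

/-- The right action `(m ⊗ n) · y = m ⊗ (n · y)` on `M ⊗_B N`. -/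
def tensorRact (M : Bimod k X B) (N : Bimod k B Y) :
    Yᵐᵒᵖ →ₐ[k] Module.End k ((M.carrier ⊗[k] N.carrier) ⧸ balance M N) :=
  AlgHom.ofLinearMap
    { toFun := fun y => (balance M N).mapQ (balance M N) _ (balance_le_right M N y)
      map_add' := fun x y => by ext; simp
      map_smul' := fun c x => by ext; simp }
    (by ext; simp) (fun x y => by ext; simp)

theorem tensor_comm (M : Bimod k X B) (N : Bimod k B Y) (x : X) (y : Yᵐᵒᵖ) :
    tensorLact M N x ∘ₗ tensorRact M N y = tensorRact M N y ∘ₗ tensorLact M N x := by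
  ext m n
  simp [tensorLact, tensorRact]

/-- The tensor product `M ⊗_B N` of an `X`-`B`-bimodule and a `B`-`Y`-bimodule, as an
`X`-`Y`-bimodule. -/
def tensor (M : Bimod k X B) (N : Bimod k B Y) : Bimod k X Y where
  carrier := (M.carrier ⊗[k] N.carrier) ⧸ balance M N
  lact := tensorLact M N
  ract := tensorRact M N
  comm := fun x y t => LinearMap.congr_fun (tensor_comm M N x y) t

end Bimod

end Bimodules

/-! ### Depth of an algebra extension -/

section Depth

variable {k : Type u} [Field k] {B A : Type u} [Ring B] [Algebra k B] [Ring A] [Algebra k A]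

/-- For an extension `f : B → A`, the `A`-`A`-bimodule `A ⊗_B ⋯ ⊗_B A` with `n + 1` factors. -/
def tensorPowerSucc (f : B →ₐ[k] A) : ℕ → Bimod k A A
  | 0 => Bimod.regular k A
  | n + 1 => Bimod.tensor ((tensorPowerSucc f n).restrict (AlgHom.id k A) f)
      ((Bimod.regular k A).restrict f (AlgHom.id k A))

/-- For an extension `f : B → A`, the `B`-`B`-bimodule `A ⊗_B ⋯ ⊗_B A` with `n` factors, which for
`n = 0` is `B`. -/
def tensorPowerRestricted (f : B →ₐ[k] A) : ℕ → Bimod k B B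
  | 0 => Bimod.regular k B
  | n + 1 => (tensorPowerSucc f n).restrict f f

/-- The minimum odd depth of `f : B → A`: the least `2 n + 1`, `n ≥ 0`, for which the `n`-fold and
the `(n + 1)`-fold tensor power of `A` over `B` are similar as `B`-`B`-bimodules, and `⊤` if there is
no such `n`. -/
noncomputable def oddDepth (f : B →ₐ[k] A) : ℕ∞ :=
  ⨅ (n : ℕ) (_ : Bimod.Similar (tensorPowerRestricted f n) (tensorPowerRestricted f (n + 1))),
    ((2 * n + 1 : ℕ) : ℕ∞)

/-- The minimum H-depth of `f : B → A`: the least `2 n - 1`, `n ≥ 1`, for which the `n`-fold and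
the `(n + 1)`-fold tensor power of `A` over `B` are similar as `A`-`A`-bimodules, and `⊤` if there is
no such `n`. The `n`-fold power is `tensorPowerSucc f (n - 1)`. -/
noncomputable def hDepth (f : B →ₐ[k] A) : ℕ∞ :=
  ⨅ (n : ℕ) (_ : 1 ≤ n)
    (_ : Bimod.Similar (tensorPowerSucc f (n - 1)) (tensorPowerSucc f n)),
    ((2 * n - 1 : ℕ) : ℕ∞)

end Depth
/-! ### Generalised factorised smash products -/

section Smash

open Coalgebra

variable (k : Type u) [Field k] (H : Type u) [Ring H] [HopfAlgebra k H]

/-- An action of `H` on the algebra `A`, `h ⊗ a ↦ h ⇀ a`, with `h ⇀ (a b) = (h₂ ⇀ a) (h₁ ⇀ b)` and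
`h ⇀ 1 = ε(h) 1`. The reversed order of `h₁` and `h₂` is the one of the action of `H` on the
opposite of the dual of a right `H`-module coalgebra. -/
structure CopAction (A : Type u) [Ring A] [Algebra k A] where
  act : H →ₐ[k] Module.End k A
  act_mul : ∀ h a b, act h (a * b) = LinearMap.mul' k A
    (TensorProduct.map (act.toLinearMap.flip a) (act.toLinearMap.flip b)
      (TensorProduct.comm k H H (comul h)))
  act_one : ∀ h, act h 1 = counit (R := k) h • (1 : A)

variable {k H} {A : Type u} [Ring A] [Algebra k A] (M : CopAction k H A)

namespace CopAction

/-- The factorisation `H ⊗ A → A ⊗ H`, `h ⊗ a ↦ (h₂ ⇀ a) ⊗ h₁`. -/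
noncomputable def psiBar : H ⊗[k] A →ₗ[k] A ⊗[k] H :=
  (TensorProduct.comm k H A).toLinearMap ∘ₗ
    (TensorProduct.lift M.act.toLinearMap).lTensor H ∘ₗ
    (TensorProduct.assoc k H H A).toLinearMap ∘ₗ
    (comul (R := k) (A := H)).rTensor A

/-- The vector space `A ⊗ H`, on which the smash product `A # H` is defined. -/
def SmashProduct (_M : CopAction k H A) : Type u := A ⊗[k] H

noncomputable instance : AddCommGroup M.SmashProduct :=
  inferInstanceAs (AddCommGroup (A ⊗[k] H))

noncomputable instance : Module k M.SmashProduct :=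
  inferInstanceAs (Module k (A ⊗[k] H))

/-- The product `(a ⊗ h) (b ⊗ g) = a ψ(h ⊗ b) g` on `A ⊗ H`, where `ψ` is `psiBar`. -/
noncomputable def smashMul : (A ⊗[k] H) ⊗[k] (A ⊗[k] H) →ₗ[k] A ⊗[k] H :=
  TensorProduct.map (LinearMap.mul' k A) (LinearMap.mul' k H) ∘ₗ
    (TensorProduct.assoc k A A (H ⊗[k] H)).symm.toLinearMap ∘ₗ
    ((TensorProduct.assoc k A H H).toLinearMap ∘ₗ
      M.psiBar.rTensor H ∘ₗ
      (TensorProduct.assoc k H A H).symm.toLinearMap).lTensor A ∘ₗ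
    (TensorProduct.assoc k A H (A ⊗[k] H)).toLinearMap

/-- The product written out: `(a # h) (b # g) = a (h₂ ⇀ b) # h₁ g`. -/
theorem smashMul_tmul {ι : Type*} (a b : A) (h g : H) (r : Coalgebra.Repr k h ι) :
    M.smashMul ((a ⊗ₜ[k] h) ⊗ₜ[k] (b ⊗ₜ[k] g)) =
      ∑ i ∈ r.index, (a * M.act (r.right i) b) ⊗ₜ[k] (r.left i * g) := by
  simp [smashMul, psiBar, ← r.eq, TensorProduct.sum_tmul, TensorProduct.tmul_sum]

theorem smash_one_mul (x : A ⊗[k] H) : M.smashMul ((1 ⊗ₜ[k] 1) ⊗ₜ[k] x) = x := by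
  induction x using TensorProduct.induction_on with
  | zero => simp
  | tmul b g => simp [smashMul, psiBar, Algebra.TensorProduct.one_def]
  | add x y hx hy => rw [TensorProduct.tmul_add, map_add, hx, hy]

theorem smash_mul_one (x : A ⊗[k] H) : M.smashMul (x ⊗ₜ[k] (1 ⊗ₜ[k] 1)) = x := by
  induction x using TensorProduct.induction_on with
  | zero => simp
  | tmul a h =>
    rw [M.smashMul_tmul a 1 h 1 (ℛ k h)]
    simp only [M.act_one, mul_smul_comm, mul_one, TensorProduct.smul_tmul]
    rw [← TensorProduct.tmul_sum]
    congr 1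
    have := congrArg (TensorProduct.rid k H) (Coalgebra.sum_tmul_counit_eq (ℛ k h))
    simpa only [map_sum, TensorProduct.rid_tmul, one_smul] using this
  | add x y hx hy => rw [TensorProduct.add_tmul, map_add, hx, hy]

/-- `h ⇀ (b c) = (h₂ ⇀ b) (h₁ ⇀ c)`, on a representative of the coproduct of `h`. -/
theorem act_mul_repr {ι : Type*} (h : H) (r : Coalgebra.Repr k h ι) (b c : A) :
    M.act h (b * c) = ∑ i ∈ r.index, M.act (r.right i) b * M.act (r.left i) c := by
  rw [M.act_mul, ← r.eq]
  simp

/-- `x ⊗ (y ⊗ z) ↦ (z ⇀ b) (y ⇀ c) ⊗ x l`. -/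
noncomputable def assocAux (b c : A) (l : H) : H ⊗[k] (H ⊗[k] H) →ₗ[k] A ⊗[k] H :=
  (TensorProduct.comm k H A).toLinearMap ∘ₗ
  TensorProduct.map (LinearMap.mulRight k l)
    (LinearMap.mul' k A ∘ₗ
      TensorProduct.map (M.act.toLinearMap.flip b) (M.act.toLinearMap.flip c) ∘ₗ
      (TensorProduct.comm k H H).toLinearMap)

theorem smash_assoc (x y z : A ⊗[k] H) :
    M.smashMul (M.smashMul (x ⊗ₜ[k] y) ⊗ₜ[k] z) = M.smashMul (x ⊗ₜ[k] M.smashMul (y ⊗ₜ[k] z)) := by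
  induction x using TensorProduct.induction_on with
  | zero => simp
  | add x x' hx hx' => simp only [TensorProduct.add_tmul, map_add, hx, hx']
  | tmul a h =>
  induction y using TensorProduct.induction_on with
  | zero => simp
  | add y y' hy hy' => simp only [TensorProduct.add_tmul, TensorProduct.tmul_add, map_add, hy, hy']
  | tmul b g =>
  induction z using TensorProduct.induction_on with
  | zero => simp
  | add z z' hz hz' => simp only [TensorProduct.tmul_add, map_add, hz, hz']
  | tmul c l =>
  have hco : ∀ j ∈ (ℛ k g).index,
      ∑ i ∈ (ℛ k h).index, ∑ i' ∈ (ℛ k ((ℛ k h).left i)).index,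
        (M.act ((ℛ k h).right i) b *
          M.act ((ℛ k ((ℛ k h).left i)).right i') (M.act ((ℛ k g).right j) c)) ⊗ₜ[k]
          ((ℛ k ((ℛ k h).left i)).left i' * ((ℛ k g).left j * l)) =
      ∑ i ∈ (ℛ k h).index, ∑ i' ∈ (ℛ k ((ℛ k h).right i)).index,
        (M.act ((ℛ k ((ℛ k h).right i)).right i') b *
          M.act ((ℛ k ((ℛ k h).right i)).left i') (M.act ((ℛ k g).right j) c)) ⊗ₜ[k]
          ((ℛ k h).left i * ((ℛ k g).left j * l)) := by
    intro j _
    have := congrArg (M.assocAux b (M.act ((ℛ k g).right j) c) ((ℛ k g).left j * l))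
      (Coalgebra.sum_tmul_tmul_eq (ℛ k h) (fun i => ℛ k ((ℛ k h).left i))
        (fun i => ℛ k ((ℛ k h).right i)))
    simpa [assocAux, mul_assoc] using this
  have key : ∀ x : H, M.smashMul (((1 : A) ⊗ₜ[k] (x * g)) ⊗ₜ[k] (c ⊗ₜ[k] l)) =
      ∑ j ∈ (ℛ k g).index, ∑ i ∈ (ℛ k x).index,
        (M.act ((ℛ k x).right i) (M.act ((ℛ k g).right j) c)) ⊗ₜ[k]
          ((ℛ k x).left i * ((ℛ k g).left j * l)) := by
    intro x
    simp only [smashMul, psiBar, LinearMap.comp_apply, LinearEquiv.coe_coe,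
      TensorProduct.assoc_tmul, TensorProduct.assoc_symm_tmul, LinearMap.lTensor_tmul,
      LinearMap.rTensor_tmul, Bialgebra.comul_mul]
    rw [← (ℛ k x).eq, ← (ℛ k g).eq]
    simp only [Finset.sum_mul_sum, Algebra.TensorProduct.tmul_mul_tmul, TensorProduct.sum_tmul,
      TensorProduct.tmul_sum, map_sum]
    rw [Finset.sum_comm]
    simp [mul_assoc]
  have hleft : ∀ (u : A) (x : H) (w : A ⊗[k] H), M.smashMul ((u ⊗ₜ[k] x) ⊗ₜ[k] w) =
      (LinearMap.mulLeft k u).rTensor H (M.smashMul ((1 ⊗ₜ[k] x) ⊗ₜ[k] w)) := by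
    intro u x w
    induction w using TensorProduct.induction_on with
    | zero => simp
    | add w w' hw hw' => simp only [TensorProduct.tmul_add, map_add, hw, hw']
    | tmul d m => simp [M.smashMul_tmul _ _ _ _ (ℛ k x)]
  rw [M.smashMul_tmul a b h g (ℛ k h), M.smashMul_tmul b c g l (ℛ k g)]
  simp only [TensorProduct.sum_tmul, TensorProduct.tmul_sum, map_sum]
  simp only [fun j => M.smashMul_tmul a (b * M.act ((ℛ k g).right j) c) h
    ((ℛ k g).left j * l) (ℛ k h)]
  have hL : ∀ i, M.smashMul (((a * M.act ((ℛ k h).right i) b) ⊗ₜ[k] ((ℛ k h).left i * g)) ⊗ₜ[k]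
      (c ⊗ₜ[k] l)) = ∑ j ∈ (ℛ k g).index, (LinearMap.mulLeft k a).rTensor H
        (∑ i' ∈ (ℛ k ((ℛ k h).left i)).index,
        (M.act ((ℛ k h).right i) b *
          M.act ((ℛ k ((ℛ k h).left i)).right i') (M.act ((ℛ k g).right j) c)) ⊗ₜ[k]
          ((ℛ k ((ℛ k h).left i)).left i' * ((ℛ k g).left j * l))) := by
    intro i
    rw [hleft, key]
    simp
  have hR : ∀ i j, (a * M.act ((ℛ k h).right i) (b * M.act ((ℛ k g).right j) c)) ⊗ₜ[k]
      ((ℛ k h).left i * ((ℛ k g).left j * l)) = (LinearMap.mulLeft k a).rTensor H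
      (∑ i' ∈ (ℛ k ((ℛ k h).right i)).index,
        (M.act ((ℛ k ((ℛ k h).right i)).right i') b *
          M.act ((ℛ k ((ℛ k h).right i)).left i') (M.act ((ℛ k g).right j) c)) ⊗ₜ[k]
          ((ℛ k h).left i * ((ℛ k g).left j * l))) := by
    intro i j
    rw [M.act_mul_repr _ (ℛ k ((ℛ k h).right i)), ← TensorProduct.sum_tmul,
      LinearMap.rTensor_tmul, LinearMap.mulLeft_apply]
  simp only [hL, hR]
  rw [Finset.sum_comm]
  refine Finset.sum_congr rfl fun j hj => ?_
  simp only [← map_sum]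
  rw [hco j hj]

noncomputable instance : Ring M.SmashProduct :=
  { (inferInstance : AddCommGroup M.SmashProduct) with
    mul := fun x y => M.smashMul (x ⊗ₜ[k] y)
    one := (1 : A) ⊗ₜ[k] (1 : H)
    mul_assoc := M.smash_assoc
    one_mul := M.smash_one_mul
    mul_one := M.smash_mul_one
    left_distrib := fun x y z => map_add (TensorProduct.curry M.smashMul x) y z
    right_distrib := fun x y z => LinearMap.map_add₂ (TensorProduct.curry M.smashMul) x y z
    zero_mul := fun x => LinearMap.map_zero₂ (TensorProduct.curry M.smashMul) x
    mul_zero := fun x => map_zero (TensorProduct.curry M.smashMul x) }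

noncomputable instance : Algebra k M.SmashProduct :=
  Algebra.ofModule
    (fun c x y => LinearMap.map_smul₂ (TensorProduct.curry M.smashMul) c x y)
    (fun c x y => map_smul (TensorProduct.curry M.smashMul x) c y)

/-- The inclusion `H → A # H`, `h ↦ 1 # h`. -/
noncomputable def inclusion : H →ₐ[k] M.SmashProduct :=
  AlgHom.ofLinearMap (TensorProduct.mk k A H 1) rfl fun x y => by
    change _ = M.smashMul ((1 ⊗ₜ[k] x) ⊗ₜ[k] (1 ⊗ₜ[k] y))
    rw [M.smashMul_tmul 1 1 x y (ℛ k x)]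
    simp only [M.act_one, one_mul, TensorProduct.smul_tmul]
    rw [← TensorProduct.tmul_sum]
    have := congrArg (TensorProduct.rid k H) (Coalgebra.sum_tmul_counit_eq (ℛ k x))
    simp only [← smul_mul_assoc, ← Finset.sum_mul]
    simp only [map_sum, TensorProduct.rid_tmul, one_smul] at this
    rw [this]
    rfl

end CopAction

end Smash

/-! ### The quotient module coalgebra of a Hopf subalgebra -/

section Quotient

open Coalgebra

/-- A Hopf subalgebra of `H`: a subalgebra `R` with `Δ(R) ⊆ R ⊗ R` and `S(R) ⊆ R`. -/
structure HopfSubalgebra (k : Type u) [Field k] (H : Type u) [Ring H] [HopfAlgebra k H]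
    extends Subalgebra k H where
  comul_mem : ∀ x ∈ toSubalgebra, comul (R := k) x ∈
    LinearMap.range (TensorProduct.map toSubalgebra.val.toLinearMap toSubalgebra.val.toLinearMap)
  antipode_mem : ∀ x ∈ toSubalgebra, HopfAlgebra.antipode k x ∈ toSubalgebra

variable {k : Type u} [Field k] {H : Type u} [Ring H] [HopfAlgebra k H]

namespace HopfSubalgebra

variable (R : HopfSubalgebra k H)

/-- The subspace `R⁺ H` of `H`, where `R⁺` is the kernel of the counit on `R`. -/
def augIdeal : Submodule k H :=
  Submodule.span k {x | ∃ r ∈ R.toSubalgebra, counit (R := k) r = 0 ∧ ∃ h : H, x = r * h}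

theorem mk_mul_eq (r : H) (hr : r ∈ R.toSubalgebra) (h : H) :
    R.augIdeal.mkQ (r * h) = counit (R := k) r • R.augIdeal.mkQ h := by
  rw [← map_smul, ← sub_eq_zero, ← map_sub, Submodule.mkQ_apply, Submodule.Quotient.mk_eq_zero]
  refine Submodule.subset_span ⟨r - algebraMap k H (counit (R := k) r),
    R.toSubalgebra.sub_mem hr (R.toSubalgebra.algebraMap_mem _), by simp, h, ?_⟩
  rw [sub_mul, Algebra.smul_def]

theorem map_mkQ_mul (t : R.toSubalgebra ⊗[k] R.toSubalgebra) (s : H ⊗[k] H) :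
    TensorProduct.map R.augIdeal.mkQ R.augIdeal.mkQ
      (TensorProduct.map R.toSubalgebra.val.toLinearMap R.toSubalgebra.val.toLinearMap t * s) =
    LinearMap.mul' k k (TensorProduct.map (counit (R := k) (A := H)) (counit (R := k) (A := H))
      (TensorProduct.map R.toSubalgebra.val.toLinearMap R.toSubalgebra.val.toLinearMap t)) •
      TensorProduct.map R.augIdeal.mkQ R.augIdeal.mkQ s := by
  induction t using TensorProduct.induction_on with
  | zero => simp
  | add t t' ht ht' => simp only [map_add, add_mul, add_smul, ht, ht']
  | tmul a b =>
    induction s using TensorProduct.induction_on with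
    | zero => simp
    | add s s' hs hs' => simp only [map_add, mul_add, smul_add, hs, hs']
    | tmul x y =>
      simp only [TensorProduct.map_tmul, Algebra.TensorProduct.tmul_mul_tmul,
        AlgHom.toLinearMap_apply, Subalgebra.coe_val, R.mk_mul_eq _ a.2, R.mk_mul_eq _ b.2,
        LinearMap.mul'_apply, TensorProduct.smul_tmul_smul]

instance : R.augIdeal.IsCoideal where
  counit_eq_zero := fun x hx => by
    have : R.augIdeal ≤ LinearMap.ker (counit (R := k) (A := H)) := by
      refine Submodule.span_le.2 ?_
      rintro _ ⟨r, -, h0, h, rfl⟩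
      simp [h0]
    exact this hx
  map_mkQ_comul_eq_zero := fun x hx => by
    have : R.augIdeal ≤ LinearMap.ker
        (TensorProduct.map R.augIdeal.mkQ R.augIdeal.mkQ ∘ₗ comul) := by
      refine Submodule.span_le.2 ?_
      rintro _ ⟨r, hr, h0, h, rfl⟩
      obtain ⟨t, ht⟩ := R.comul_mem r hr
      have hc : LinearMap.mul' k k (TensorProduct.map (counit (R := k) (A := H))
          (counit (R := k) (A := H)) (comul (R := k) r)) = counit (R := k) r := by
        have h1 := congrArg (LinearMap.mul' k k ∘ₗ
          (counit (R := k) (A := H)).lTensor k) (rTensor_counit_comul (R := k) r)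
        rw [← (ℛ k r).eq] at h1 ⊢
        simp at h1 ⊢
      rw [SetLike.mem_coe, LinearMap.mem_ker, LinearMap.comp_apply, Bialgebra.comul_mul, ← ht,
        R.map_mkQ_mul, ht, hc, h0, zero_smul]
    exact this hx

/-- The quotient module coalgebra `Q = H / R⁺ H`; its coalgebra structure is the one of the
quotient of `H` by a coideal. -/
abbrev Q : Type u := H ⧸ R.augIdeal

theorem augIdeal_le (h : H) : R.augIdeal ≤ R.augIdeal.comap (LinearMap.mulRight k h) := by
  refine Submodule.span_le.2 ?_
  rintro _ ⟨r, hr, h0, g, rfl⟩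
  exact Submodule.subset_span ⟨r, hr, h0, g * h, by simp [mul_assoc]⟩

/-- The right action of `h : H` on `Q`: the class of `x` goes to the class of `x h`. -/
def rightMul (h : H) : R.Q →ₗ[k] R.Q :=
  R.augIdeal.mapQ R.augIdeal (LinearMap.mulRight k h) (R.augIdeal_le h)

theorem rightMul_add (h g : H) : R.rightMul (h + g) = R.rightMul h + R.rightMul g := by
  ext x
  simp [rightMul, mul_add]

theorem rightMul_smul (c : k) (h : H) : R.rightMul (c • h) = c • R.rightMul h := by
  ext x
  simp [rightMul]

theorem rightMul_one : R.rightMul 1 = LinearMap.id := by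
  ext x
  simp [rightMul]

theorem rightMul_mul (h g : H) : R.rightMul (h * g) = R.rightMul g ∘ₗ R.rightMul h := by
  ext x
  simp [rightMul, mul_assoc]

/-- The algebra `Q^{*op}`: the opposite of the convolution algebra of the coalgebra `Q`, with
`(θ γ)(x) = θ(x₂) γ(x₁)`. -/
abbrev QDualOp : Type u := (WithConv (R.Q →ₗ[k] k))ᵐᵒᵖ

/-- The linear map `h ⇀ -` on `Q^{*op}`: `(h ⇀ θ)(x) = θ(x h)`. -/
def hit (h : H) : R.QDualOp →ₗ[k] R.QDualOp where
  toFun θ := MulOpposite.op (WithConv.toConv (θ.unop.ofConv ∘ₗ R.rightMul h))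
  map_add' _ _ := rfl
  map_smul' _ _ := rfl

theorem qDualOp_ext {θ γ : R.QDualOp} (h : ∀ x : R.Q, θ.unop.ofConv x = γ.unop.ofConv x) : θ = γ :=
  MulOpposite.unop_injective (WithConv.ext (LinearMap.ext h))

theorem hit_apply (h : H) (θ : R.QDualOp) (x : R.Q) :
    (R.hit h θ).unop.ofConv x = θ.unop.ofConv (R.rightMul h x) := rfl

theorem qDualOp_mul_apply (θ γ : R.QDualOp) (x : R.Q) :
    (θ * γ).unop.ofConv x =
      LinearMap.mul' k k (TensorProduct.map γ.unop.ofConv θ.unop.ofConv (comul x)) := rfl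

/-- `h ↦ (h ⇀ -)` as an algebra homomorphism. -/
noncomputable def hitHom : H →ₐ[k] Module.End k R.QDualOp :=
  AlgHom.ofLinearMap
    { toFun := R.hit
      map_add' := fun h g => LinearMap.ext fun θ => R.qDualOp_ext fun x => by
        rw [hit_apply, rightMul_add, LinearMap.add_apply, map_add]
        rfl
      map_smul' := fun c h => LinearMap.ext fun θ => R.qDualOp_ext fun x => by
        rw [hit_apply, rightMul_smul, LinearMap.smul_apply, map_smul]
        rfl }
    (LinearMap.ext fun θ => R.qDualOp_ext fun x => by
      change (R.hit 1 θ).unop.ofConv x = _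
      rw [hit_apply, rightMul_one]
      rfl)
    (fun h g => LinearMap.ext fun θ => R.qDualOp_ext fun x => by
      change (R.hit (h * g) θ).unop.ofConv x = (R.hit h (R.hit g θ)).unop.ofConv x
      rw [hit_apply, hit_apply, hit_apply, rightMul_mul]
      rfl)

theorem hitHom_apply (h : H) (θ : R.QDualOp) : R.hitHom h θ = R.hit h θ := rfl

theorem comul_rightMul (h : H) (x : R.Q) : comul (R := k) (R.rightMul h x) =
    ∑ i ∈ (ℛ k h).index, TensorProduct.map (R.rightMul ((ℛ k h).left i))
      (R.rightMul ((ℛ k h).right i)) (comul x) := by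
  obtain ⟨x, rfl⟩ := Submodule.Quotient.mk_surjective _ x
  have h1 : R.rightMul h (Submodule.Quotient.mk x) = Submodule.Quotient.mk (x * h) := rfl
  rw [h1, Coalgebra.Quotient.comul_mk, Coalgebra.Quotient.comul_mk, Bialgebra.comul_mul]
  conv_lhs => rw [← (ℛ k h).eq]
  rw [← (ℛ k x).eq]
  simp only [Finset.sum_mul_sum, Algebra.TensorProduct.tmul_mul_tmul, map_sum,
    TensorProduct.map_tmul]
  rw [Finset.sum_comm]
  rfl

theorem hit_mul (h : H) (θ γ : R.QDualOp) : R.hit h (θ * γ) =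
    ∑ i ∈ (ℛ k h).index, R.hit ((ℛ k h).right i) θ * R.hit ((ℛ k h).left i) γ :=
  R.qDualOp_ext fun x => by
    rw [hit_apply, qDualOp_mul_apply, comul_rightMul]
    simp only [Finset.unop_sum, WithConv.ofConv_sum, LinearMap.sum_apply, map_sum,
      qDualOp_mul_apply]
    refine Finset.sum_congr rfl fun i _ => ?_
    rw [TensorProduct.map_map]
    rfl

/-- The action of `H` on the algebra `Q^{*op}` with `(h ⇀ θ)(x) = θ(x h)`. -/
noncomputable def copAction : CopAction k H R.QDualOp where
  act := R.hitHom
  act_mul := fun h θ γ => by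
    rw [hitHom_apply, hit_mul, ← (ℛ k h).eq]
    simp only [map_sum, TensorProduct.comm_tmul, TensorProduct.map_tmul, LinearMap.mul'_apply]
    rfl
  act_one := fun h => R.qDualOp_ext fun x => by
    obtain ⟨x, rfl⟩ := Submodule.Quotient.mk_surjective _ x
    change counit (R := k) (x * h) = counit (R := k) h * counit (R := k) x
    rw [Bialgebra.counit_mul, mul_comm]

/-- The generalised factorised smash product `Q^{*op} # H`, with product
`(θ # h) (γ # g) = θ (h₂ ⇀ γ) # h₁ g`. -/
abbrev GenSmash : Type u := R.copAction.SmashProduct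

end HopfSubalgebra

end Quotient

end HopfDepth

/-!
Write `A` for the smash product `Q^{*op} # H`. The `H`-`H`-bimodule `A` is the left `H`-dual of
`H ⊗_R H`, and taking left duals turns direct sum decompositions of bimodules that are finitely
generated projective on the left into direct sum decompositions of the duals. As it also reverses
tensor products over `H`, the `n`-th tensor power of `A` over `H` is the left dual of the
`(n + 1)`-st tensor power of `H` over `R`. Hence consecutive powers on one side are similar exactly
when they are on the other, and both depths are infima over the same `n`.

To make this explicit, both families of tensor powers are compared with iterated twists of `H`.

* For a right `H`-module `V`, `twistRight` is the bimodule `M ⊗ V` with the diagonal right action,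
  and `M ⊗_R H ≅ M ⊗ Q` by `m ⊗ h ↦ m h₁ ⊗ h₂`, with inverse `m ⊗ h ↦ m S(h₁) ⊗ h₂`
  (`HopfSubalgebra.extend_isom`). So the `(n + 1)`-st power of `H` over `R` is `H` twisted `n` times
  by `Q`.
* For a left `H`-module `W`, `twistLeft` is the bimodule `W ⊗ N` with left action
  `h (w ⊗ n) = h₂ w ⊗ h₁ n`. By the formula for its product, `A` is the twist of `H` by `Q^{*op}`,
  and `twistLeft` commutes with tensor products on the right (`twistLeft_tensor`). So the `n`-th
  power of `A` over `H` is `H` twisted `n` times by `Q^{*op}`.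
* `Duality` is a pairing of bimodules with finite dual bases. It passes from `M` and `N` to `M ⊗ Q`
  and `Q^{*op} ⊗ N` (`Duality.twist`), and homomorphisms have adjoints with respect to it, which
  gives `Duality.similar_iff`.
-/

namespace HopfDepth

/-! ### Homomorphisms and divisibility of bimodules -/

section BimoduleCalculus

variable {k : Type u} [Field k] {X Y B : Type u} [Ring X] [Algebra k X] [Ring Y] [Algebra k Y]
  [Ring B] [Algebra k B]

namespace Bimod

theorem IsHom.comp {M N P : Bimod k X Y} {g : N.carrier →ₗ[k] P.carrier}
    {f : M.carrier →ₗ[k] N.carrier} (hg : IsHom N P g) (hf : IsHom M N f) : IsHom M P (g ∘ₗ f) :=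
  ⟨fun x m => by simp [hf.1, hg.1], fun y m => by simp [hf.2, hg.2]⟩

/-- Divisibility in terms of families of homomorphisms `M → N` and `N → M`. -/
theorem divides_iff (M N : Bimod k X Y) : Divides M N ↔
    ∃ (p : ℕ) (i : Fin p → M.carrier →ₗ[k] N.carrier) (r : Fin p → N.carrier →ₗ[k] M.carrier),
      (∀ j, IsHom M N (i j)) ∧ (∀ j, IsHom N M (r j)) ∧ ∀ m, ∑ j, r j (i j m) = m := by
  constructor
  · rintro ⟨p, i, r, hi, hr, h⟩
    let s (j : Fin p) : N.carrier →ₗ[k] (N.power p).carrier :=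
      LinearMap.single k (fun _ : Fin p => N.carrier) j
    refine ⟨p, fun j => LinearMap.proj j ∘ₗ i, fun j => r ∘ₗ s j,
      fun j => ⟨fun x m => ?_, fun y m => ?_⟩, fun j => ⟨fun x m => ?_, fun y m => ?_⟩,
      fun m => ?_⟩
    · exact congrFun (hi.1 x m) j
    · exact congrFun (hi.2 y m) j
    · refine Eq.trans ?_ (hr.1 x _)
      refine congrArg r (funext fun l => ?_)
      exact (Pi.apply_single (fun _ => N.lact x) (fun _ => map_zero _) j m l).symm
    · refine Eq.trans ?_ (hr.2 y _)
      refine congrArg r (funext fun l => ?_)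
      exact (Pi.apply_single (fun _ => N.ract y) (fun _ => map_zero _) j m l).symm
    · have h2 : i m = ∑ j, s j ((i m : Fin p → N.carrier) j) := (Finset.univ_sum_single (i m)).symm
      have h1 := LinearMap.congr_fun h m
      rw [LinearMap.comp_apply, h2] at h1
      exact (map_sum r _ _).symm.trans h1
  · rintro ⟨p, i, r, hi, hr, h⟩
    let π (j : Fin p) : (N.power p).carrier →ₗ[k] N.carrier :=
      LinearMap.proj (φ := fun _ : Fin p => N.carrier) j
    let i' : M.carrier →ₗ[k] (N.power p).carrier := LinearMap.pi i
    refine ⟨p, i', ∑ j, r j ∘ₗ π j, ⟨fun x m => ?_, fun y m => ?_⟩,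
      ⟨fun x m => ?_, fun y m => ?_⟩, LinearMap.ext fun m => ?_⟩
    · exact funext fun j => (hi j).1 x m
    · exact funext fun j => (hi j).2 y m
    · rw [LinearMap.sum_apply, LinearMap.sum_apply, map_sum]
      exact Finset.sum_congr rfl fun j _ => (hr j).1 x _
    · rw [LinearMap.sum_apply, LinearMap.sum_apply, map_sum]
      exact Finset.sum_congr rfl fun j _ => (hr j).2 y _
    · rw [LinearMap.comp_apply, LinearMap.sum_apply]
      exact h m

/-- Isomorphism of bimodules. -/
def Isom (M N : Bimod k X Y) : Prop := ∃ e : M.carrier ≃ₗ[k] N.carrier, IsHom M N e.toLinearMap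

namespace Isom

theorem refl (M : Bimod k X Y) : Isom M M :=
  ⟨LinearEquiv.refl k _, fun _ _ => rfl, fun _ _ => rfl⟩

theorem isHom_symm {M N : Bimod k X Y} {e : M.carrier ≃ₗ[k] N.carrier}
    (h : IsHom M N e.toLinearMap) : IsHom N M e.symm.toLinearMap :=
  ⟨fun x n => e.injective (by simpa using (h.1 x (e.symm n)).symm),
    fun y n => e.injective (by simpa using (h.2 y (e.symm n)).symm)⟩

theorem symm {M N : Bimod k X Y} : Isom M N → Isom N M
  | ⟨e, h⟩ => ⟨e.symm, isHom_symm h⟩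

theorem trans {M N P : Bimod k X Y} : Isom M N → Isom N P → Isom M P
  | ⟨e, h⟩, ⟨e', h'⟩ => ⟨e.trans e', IsHom.comp h' h⟩

end Isom

theorem Divides.congr {M N M' N' : Bimod k X Y} (hM : Isom M M') (hN : Isom N N')
    (h : Divides M N) : Divides M' N' := by
  rw [divides_iff] at h ⊢
  obtain ⟨p, i, r, hi, hr, h⟩ := h
  obtain ⟨e, he⟩ := hM
  obtain ⟨e', he'⟩ := hN
  refine ⟨p, fun j => e'.toLinearMap ∘ₗ i j ∘ₗ e.symm.toLinearMap,
    fun j => e.toLinearMap ∘ₗ r j ∘ₗ e'.symm.toLinearMap,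
    fun j => he'.comp ((hi j).comp (Isom.isHom_symm he)),
    fun j => he.comp ((hr j).comp (Isom.isHom_symm he')), fun m => ?_⟩
  simpa using congrArg e (h (e.symm m))

theorem similar_congr {M N M' N' : Bimod k X Y} (hM : Isom M M') (hN : Isom N N') :
    Similar M N ↔ Similar M' N' :=
  ⟨fun h => ⟨h.1.congr hM hN, h.2.congr hN hM⟩,
    fun h => ⟨h.1.congr hM.symm hN.symm, h.2.congr hN.symm hM.symm⟩⟩

/-- The linear map `x ↦ n · x` for a fixed element `n`. -/
def ractFlip (N : Bimod k Y X) (n : N.carrier) : X →ₗ[k] N.carrier :=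
  N.ract.toLinearMap.flip n ∘ₗ (MulOpposite.opLinearEquiv k).toLinearMap

theorem ractFlip_apply (N : Bimod k Y X) (n : N.carrier) (x : X) :
    ractFlip N n x = N.ract (MulOpposite.op x) n := rfl

/-! ### Tensor products over a noncommutative algebra -/

/-- The class of `m ⊗ n` in `M ⊗_B N`, as a bilinear map. -/
def tmk (M : Bimod k X B) (N : Bimod k B Y) :
    M.carrier →ₗ[k] N.carrier →ₗ[k] (tensor M N).carrier :=
  (TensorProduct.mk k M.carrier N.carrier).compr₂ (balance M N).mkQ

theorem tmk_balanced (M : Bimod k X B) (N : Bimod k B Y) (m : M.carrier) (b : B) (n : N.carrier) :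
    tmk M N (M.ract (MulOpposite.op b) m) n = tmk M N m (N.lact b n) :=
  (Submodule.Quotient.eq _).2 (Submodule.subset_span ⟨m, b, n, rfl⟩)

theorem tensor_lact_tmk (M : Bimod k X B) (N : Bimod k B Y) (x : X) (m : M.carrier)
    (n : N.carrier) : (tensor M N).lact x (tmk M N m n) = tmk M N (M.lact x m) n := rfl

theorem tensor_ract_tmk (M : Bimod k X B) (N : Bimod k B Y) (y : Yᵐᵒᵖ) (m : M.carrier)
    (n : N.carrier) : (tensor M N).ract y (tmk M N m n) = tmk M N m (N.ract y n) := rfl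

theorem tensor_hom_ext {M : Bimod k X B} {N : Bimod k B Y} {P : Type*} [AddCommGroup P] [Module k P]
    {f g : (tensor M N).carrier →ₗ[k] P} (h : ∀ m n, f (tmk M N m n) = g (tmk M N m n)) : f = g :=
  Submodule.linearMap_qext _ (TensorProduct.ext' h)

/-- The linear map out of `M ⊗_B N` given by a `B`-balanced bilinear map. -/
def tensorLift {M : Bimod k X B} {N : Bimod k B Y} {P : Type*} [AddCommGroup P] [Module k P]
    (f : M.carrier →ₗ[k] N.carrier →ₗ[k] P)
    (hf : ∀ m b n, f (M.ract (MulOpposite.op b) m) n = f m (N.lact b n)) :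
    (tensor M N).carrier →ₗ[k] P :=
  (balance M N).liftQ (TensorProduct.lift f) (Submodule.span_le.2 (by
    rintro _ ⟨m, b, n, rfl⟩
    simp [hf]))

theorem tensorLift_tmk {M : Bimod k X B} {N : Bimod k B Y} {P : Type*} [AddCommGroup P] [Module k P]
    (f : M.carrier →ₗ[k] N.carrier →ₗ[k] P)
    (hf : ∀ m b n, f (M.ract (MulOpposite.op b) m) n = f m (N.lact b n)) (m : M.carrier)
    (n : N.carrier) : tensorLift f hf (tmk M N m n) = f m n :=
  TensorProduct.lift.tmul m n

theorem isHom_of_tmk {M : Bimod k X B} {N : Bimod k B Y} {P : Bimod k X Y}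
    {f : (tensor M N).carrier →ₗ[k] P.carrier}
    (hl : ∀ x m n, f (tmk M N (M.lact x m) n) = P.lact x (f (tmk M N m n)))
    (hr : ∀ y m n, f (tmk M N m (N.ract y n)) = P.ract y (f (tmk M N m n))) :
    IsHom (tensor M N) P f := by
  refine ⟨fun x t => ?_, fun y t => ?_⟩
  · exact LinearMap.congr_fun (f := f ∘ₗ (tensor M N).lact x) (g := P.lact x ∘ₗ f)
      (tensor_hom_ext fun m n => hl x m n) t
  · exact LinearMap.congr_fun (f := f ∘ₗ (tensor M N).ract y) (g := P.ract y ∘ₗ f)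
      (tensor_hom_ext fun m n => hr y m n) t

/-- The map `M ⊗_B N → M' ⊗_B N'` induced by homomorphisms `M → M'` and `N → N'`. -/
def tensorMap {M M' : Bimod k X B} {N N' : Bimod k B Y} (f : M.carrier →ₗ[k] M'.carrier)
    (g : N.carrier →ₗ[k] N'.carrier) (hf : IsHom M M' f) (hg : IsHom N N' g) :
    (tensor M N).carrier →ₗ[k] (tensor M' N').carrier :=
  tensorLift ((tmk M' N').compl₁₂ f g) fun m b n => by
    simp [hf.2, hg.1, tmk_balanced]

theorem Isom.tensor {M M' : Bimod k X B} {N N' : Bimod k B Y} :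
    Isom M M' → Isom N N' → Isom (tensor M N) (tensor M' N')
  | ⟨e, he⟩, ⟨e', he'⟩ => by
    refine ⟨LinearEquiv.ofLinearMap (tensorMap _ _ he he')
      (tensorMap _ _ (isHom_symm he) (isHom_symm he'))
      (tensor_hom_ext fun m n => ?_) (tensor_hom_ext fun m n => ?_),
      isHom_of_tmk (fun x m n => ?_) (fun x m n => ?_)⟩
    · simp [tensorMap, tensorLift_tmk]
    · simp [tensorMap, tensorLift_tmk]
    · have := he.1 x m
      simp_all [tensorMap, tensorLift_tmk, tensor_lact_tmk]
    · have := he'.2 x n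
      simp_all [tensorMap, tensorLift_tmk, tensor_ract_tmk]

/-- The unit element of the regular bimodule. -/
def regularOne (k : Type u) [Field k] (B : Type u) [Ring B] [Algebra k B] :
    (regular k B).carrier := (1 : B)

/-- The action map `B × N → N`, with `B` regarded as the regular bimodule. -/
def regularAct (N : Bimod k B Y) :
    (regular k B).carrier →ₗ[k] N.carrier →ₗ[k] N.carrier := N.lact.toLinearMap

theorem regularAct_lact (N : Bimod k B Y) (x : B) (m : (regular k B).carrier) (n : N.carrier) :
    regularAct N ((regular k B).lact x m) n = N.lact x (regularAct N m n) :=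
  LinearMap.congr_fun (map_mul N.lact x m) n

theorem regularAct_ract (N : Bimod k B Y) (m : (regular k B).carrier) (b : B) (n : N.carrier) :
    regularAct N ((regular k B).ract (MulOpposite.op b) m) n = regularAct N m (N.lact b n) :=
  LinearMap.congr_fun (N.lact.map_mul m b) n

theorem regularAct_regularOne (N : Bimod k B Y) (n : N.carrier) :
    regularAct N (regularOne k B) n = n :=
  LinearMap.congr_fun (map_one N.lact) n

theorem ract_regularOne (m : (regular k B).carrier) :
    (regular k B).ract (MulOpposite.op m) (regularOne k B) = m :=
  one_mul (M := B) m

/-- `B ⊗_B N ≅ N`. -/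
theorem regular_tensor (N : Bimod k B Y) : Isom (tensor (regular k B) N) N := by
  refine ⟨LinearEquiv.ofLinearMap (tensorLift (regularAct N) (regularAct_ract N))
    (tmk (regular k B) N (regularOne k B)) (LinearMap.ext fun n => ?_)
    (tensor_hom_ext fun m n => ?_),
    isHom_of_tmk (fun x m n => ?_) (fun x m n => ?_)⟩
  · rw [LinearMap.comp_apply, tensorLift_tmk, regularAct_regularOne]
    rfl
  · rw [LinearMap.comp_apply, tensorLift_tmk]
    refine (tmk_balanced (regular k B) N (regularOne k B) m n).symm.trans ?_
    rw [ract_regularOne]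
    rfl
  · rw [LinearEquiv.toLinearMap_ofLinearMap, tensorLift_tmk, tensorLift_tmk, regularAct_lact]
  · rw [LinearEquiv.toLinearMap_ofLinearMap, tensorLift_tmk, tensorLift_tmk]
    exact N.comm m x n

/-! ### Duality of bimodules -/

/-- A duality between an `X`-`Y`-bimodule `M` and a `Y`-`X`-bimodule `N`: a `Y`-balanced pairing
`M × N → X` of bimodules with finite dual bases. It makes `M` finitely generated projective as a
left `X`-module, and `N` the bimodule of left `X`-linear maps from `M` to `X`. -/
structure Duality (M : Bimod k X Y) (N : Bimod k Y X) where
  pair : M.carrier →ₗ[k] N.carrier →ₗ[k] X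
  pair_lact : ∀ x m n, pair (M.lact x m) n = x * pair m n
  pair_ract : ∀ x m n, pair m (N.ract (MulOpposite.op x) n) = pair m n * x
  pair_balanced : ∀ y m n, pair (M.ract (MulOpposite.op y) m) n = pair m (N.lact y n)
  ι : Type
  [fintype : Fintype ι]
  left : ι → M.carrier
  right : ι → N.carrier
  left_expand : ∀ m, ∑ i, M.lact (pair m (right i)) (left i) = m
  right_expand : ∀ n, ∑ i, N.ract (MulOpposite.op (pair (left i) n)) (right i) = n

attribute [instance] Duality.fintype

namespace Duality

variable {M M' : Bimod k X Y} {N N' : Bimod k Y X}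

theorem right_ext (D : Duality M N) {n n' : N.carrier} (h : ∀ m, D.pair m n = D.pair m n') :
    n = n' := by
  rw [← D.right_expand n, ← D.right_expand n']
  simp only [h]

theorem left_ext (D : Duality M N) {m m' : M.carrier} (h : ∀ n, D.pair m n = D.pair m' n) :
    m = m' := by
  rw [← D.left_expand m, ← D.left_expand m']
  simp only [h]

/-- The adjoint `N' → N` of a homomorphism `f : M → M'`. -/
noncomputable def transpose (D : Duality M N) (D' : Duality M' N')
    (f : M.carrier →ₗ[k] M'.carrier) : N'.carrier →ₗ[k] N.carrier :=
  ∑ i, ractFlip N (D.right i) ∘ₗ D'.pair (f (D.left i))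

/-- `⟨m, fᵗ n⟩ = ⟨f m, n⟩`. -/
theorem pair_transpose (D : Duality M N) (D' : Duality M' N') {f : M.carrier →ₗ[k] M'.carrier}
    (hf : IsHom M M' f) (m : M.carrier) (n : N'.carrier) :
    D.pair m (D.transpose D' f n) = D'.pair (f m) n := by
  conv_rhs => rw [← D.left_expand m]
  simp [transpose, ractFlip, hf.1, D.pair_ract, D'.pair_lact]

theorem isHom_transpose (D : Duality M N) (D' : Duality M' N') {f : M.carrier →ₗ[k] M'.carrier}
    (hf : IsHom M M' f) : IsHom N' N (D.transpose D' f) := by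
  refine ⟨fun y n => D.right_ext fun m => ?_, fun x n => D.right_ext fun m => ?_⟩
  · rw [D.pair_transpose D' hf, ← D.pair_balanced, D.pair_transpose D' hf, hf.2, D'.pair_balanced]
  · induction x using MulOpposite.rec' with | _ x => ?_
    rw [D.pair_transpose D' hf, D.pair_ract, D.pair_transpose D' hf, D'.pair_ract]

/-- The adjoint `M' → M` of a homomorphism `g : N → N'`. -/
noncomputable def cotranspose (D : Duality M N) (D' : Duality M' N')
    (g : N.carrier →ₗ[k] N'.carrier) : M'.carrier →ₗ[k] M.carrier :=
  ∑ i, M.lact.toLinearMap.flip (D.left i) ∘ₗ D'.pair.flip (g (D.right i))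

/-- `⟨gᵗ m, n⟩ = ⟨m, g n⟩`. -/
theorem pair_cotranspose (D : Duality M N) (D' : Duality M' N') {g : N.carrier →ₗ[k] N'.carrier}
    (hg : IsHom N N' g) (m : M'.carrier) (n : N.carrier) :
    D.pair (D.cotranspose D' g m) n = D'.pair m (g n) := by
  conv_rhs => rw [← D.right_expand n]
  simp [cotranspose, hg.2, D.pair_lact, D'.pair_ract]

theorem isHom_cotranspose (D : Duality M N) (D' : Duality M' N') {g : N.carrier →ₗ[k] N'.carrier}
    (hg : IsHom N N' g) : IsHom M' M (D.cotranspose D' g) := by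
  refine ⟨fun x m => D.left_ext fun n => ?_, fun y m => D.left_ext fun n => ?_⟩
  · rw [D.pair_cotranspose D' hg, D.pair_lact, D.pair_cotranspose D' hg, D'.pair_lact]
  · induction y using MulOpposite.rec' with | _ y => ?_
    rw [D.pair_cotranspose D' hg, D.pair_balanced, D.pair_cotranspose D' hg, D'.pair_balanced, hg.1]

theorem divides_right (D : Duality M N) (D' : Duality M' N') (h : Divides M M') :
    Divides N N' := by
  rw [divides_iff] at h ⊢
  obtain ⟨p, i, r, hi, hr, h⟩ := h
  refine ⟨p, fun j => D'.transpose D (r j), fun j => D.transpose D' (i j),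
    fun j => D'.isHom_transpose D (hr j), fun j => D.isHom_transpose D' (hi j),
    fun n => D.right_ext fun m => ?_⟩
  conv_rhs => rw [← h m]
  simp only [map_sum, LinearMap.sum_apply]
  exact Finset.sum_congr rfl fun j _ => by
    rw [D.pair_transpose D' (hi j), D'.pair_transpose D (hr j)]

theorem divides_left (D : Duality M N) (D' : Duality M' N') (h : Divides N N') :
    Divides M M' := by
  rw [divides_iff] at h ⊢
  obtain ⟨p, i, r, hi, hr, h⟩ := h
  refine ⟨p, fun j => D'.cotranspose D (r j), fun j => D.cotranspose D' (i j),
    fun j => D'.isHom_cotranspose D (hr j), fun j => D.isHom_cotranspose D' (hi j),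
    fun m => D.left_ext fun n => ?_⟩
  conv_rhs => rw [← h n]
  simp only [map_sum, LinearMap.sum_apply]
  exact Finset.sum_congr rfl fun j _ => by
    rw [D.pair_cotranspose D' (hi j), D'.pair_cotranspose D (hr j)]

theorem similar_iff (D : Duality M N) (D' : Duality M' N') : Similar M M' ↔ Similar N N' :=
  ⟨fun h => ⟨D.divides_right D' h.1, D'.divides_right D h.2⟩,
    fun h => ⟨D.divides_left D' h.1, D'.divides_left D h.2⟩⟩

/-- An algebra is dual to itself by its multiplication. -/
noncomputable def regular (k : Type u) [Field k] (X : Type u) [Ring X] [Algebra k X] :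
    Duality (Bimod.regular k X) (Bimod.regular k X) where
  pair := LinearMap.mul k X
  pair_lact _ _ _ := mul_assoc _ _ _
  pair_ract _ _ _ := (mul_assoc _ _ _).symm
  pair_balanced _ _ _ := mul_assoc _ _ _
  ι := Unit
  left _ := (1 : X)
  right _ := (1 : X)
  left_expand (m : X) := by
    simp only [Finset.univ_unique, Finset.sum_singleton]
    change (m * 1) * 1 = m
    simp
  right_expand (n : X) := by
    simp only [Finset.univ_unique, Finset.sum_singleton]
    change 1 * (1 * n) = n
    simp

end Duality

end Bimod

end BimoduleCalculus

/-! ### Twisting a bimodule by a module over a Hopf algebra -/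

section Twist

open Coalgebra

variable {k : Type u} [Field k] {H : Type u} [Ring H] [HopfAlgebra k H]
  {X Y : Type u} [Ring X] [Algebra k X] [Ring Y] [Algebra k Y]

namespace Bimod

section TwistRight

variable {V : Type u} [AddCommGroup V] [Module k V] (ρ : Hᵐᵒᵖ →ₐ[k] Module.End k V)

/-- The diagonal right action `(m ⊗ v) · h = m h₁ ⊗ v h₂` on `M ⊗ V`. -/
noncomputable def diagRact (M : Bimod k X H) : Hᵐᵒᵖ →ₐ[k] Module.End k (M.carrier ⊗[k] V) :=
  ((Module.endTensorEndAlgHom (R := k) (S := k) (A := k)).comp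
    (Algebra.TensorProduct.map M.ract ρ)).comp
    ((Algebra.TensorProduct.opAlgEquiv k k H H).symm.toAlgHom.comp
      (AlgHom.op (Bialgebra.comulAlgHom k H)))

theorem diagRact_op (M : Bimod k X H) {ι : Type*} (h : H) (r : Coalgebra.Repr k h ι) :
    diagRact ρ M (MulOpposite.op h) = ∑ i ∈ r.index,
      TensorProduct.map (M.ract (MulOpposite.op (r.left i))) (ρ (MulOpposite.op (r.right i))) := by
  simp only [diagRact, AlgHom.comp_apply, AlgHom.op_apply_apply, MulOpposite.unop_op,
    Bialgebra.comulAlgHom_apply, ← r.eq, map_sum, Finset.op_sum]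
  rfl

/-- For a right `H`-module `V`, the bimodule `M ⊗ V` with left action on `M` and diagonal right
action `(m ⊗ v) · h = m h₁ ⊗ v h₂`. -/
noncomputable def twistRight (M : Bimod k X H) : Bimod k X H where
  carrier := M.carrier ⊗[k] V
  lact := (Module.endTensorEndAlgHom (R := k) (S := k) (A := k)).comp
    (Algebra.TensorProduct.includeLeft.comp M.lact)
  ract := diagRact ρ M
  comm x y t := by
    induction y using MulOpposite.rec' with | _ h => ?_
    rw [diagRact_op ρ M h (ℛ k h)]
    simp only [LinearMap.sum_apply, map_sum]
    refine Finset.sum_congr rfl fun i _ => ?_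
    induction t using TensorProduct.induction_on with
    | zero => simp
    | add t t' ht ht' => simp only [map_add, ht, ht']
    | tmul m v => simp [Module.endTensorEndAlgHom_apply, M.comm]

/-- The element `m ⊗ v` of `twistRight ρ M`, as a bilinear map. -/
noncomputable def rmk (M : Bimod k X H) : M.carrier →ₗ[k] V →ₗ[k] (twistRight ρ M).carrier :=
  TensorProduct.mk k M.carrier V

theorem twistRight_lact_rmk (M : Bimod k X H) (x : X) (m : M.carrier) (v : V) :
    (twistRight ρ M).lact x (rmk ρ M m v) = rmk ρ M (M.lact x m) v := rfl

theorem twistRight_ract_rmk (M : Bimod k X H) {ι : Type*} (h : H) (r : Coalgebra.Repr k h ι)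
    (m : M.carrier) (v : V) : (twistRight ρ M).ract (MulOpposite.op h) (rmk ρ M m v) =
      ∑ i ∈ r.index, rmk ρ M (M.ract (MulOpposite.op (r.left i)) m)
        (ρ (MulOpposite.op (r.right i)) v) := by
  change diagRact ρ M (MulOpposite.op h) (m ⊗ₜ[k] v) = _
  rw [diagRact_op ρ M h r, LinearMap.sum_apply]
  rfl

theorem twistRight_hom_ext {M : Bimod k X H} {P : Type*} [AddCommGroup P] [Module k P]
    {f g : (twistRight ρ M).carrier →ₗ[k] P} (h : ∀ m v, f (rmk ρ M m v) = g (rmk ρ M m v)) :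
    f = g :=
  TensorProduct.ext' h

/-- The linear map out of `twistRight ρ M` given by a bilinear map. -/
noncomputable def twistRightLift {M : Bimod k X H} {P : Type*} [AddCommGroup P] [Module k P]
    (f : M.carrier →ₗ[k] V →ₗ[k] P) : (twistRight ρ M).carrier →ₗ[k] P :=
  TensorProduct.lift f

theorem twistRightLift_rmk {M : Bimod k X H} {P : Type*} [AddCommGroup P] [Module k P]
    (f : M.carrier →ₗ[k] V →ₗ[k] P) (m : M.carrier) (v : V) :
    twistRightLift ρ f (rmk ρ M m v) = f m v := rfl

theorem isHom_of_rmk {M N : Bimod k X H} {f : (twistRight ρ M).carrier →ₗ[k] N.carrier}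
    (hl : ∀ x m v, f (rmk ρ M (M.lact x m) v) = N.lact x (f (rmk ρ M m v)))
    (hr : ∀ h m v, f ((twistRight ρ M).ract (MulOpposite.op h) (rmk ρ M m v)) =
      N.ract (MulOpposite.op h) (f (rmk ρ M m v))) :
    IsHom (twistRight ρ M) N f :=
  ⟨fun x t => LinearMap.congr_fun (f := f ∘ₗ (twistRight ρ M).lact x) (g := N.lact x ∘ₗ f)
      (twistRight_hom_ext ρ fun m n => hl x m n) t,
    fun y t => LinearMap.congr_fun (f := f ∘ₗ (twistRight ρ M).ract y) (g := N.ract y ∘ₗ f)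
      (twistRight_hom_ext ρ fun m n => hr y.unop m n) t⟩

theorem Isom.twistRight_congr {M N : Bimod k X H} :
    Isom M N → Isom (twistRight ρ M) (twistRight ρ N)
  | ⟨e, he⟩ => by
    refine ⟨LinearEquiv.ofLinearMap (twistRightLift ρ (rmk ρ N ∘ₗ e.toLinearMap))
      (twistRightLift ρ (rmk ρ M ∘ₗ e.symm.toLinearMap))
      (twistRight_hom_ext ρ fun m v => ?_) (twistRight_hom_ext ρ fun m v => ?_),
      isHom_of_rmk ρ (fun x m v => ?_) fun h m v => ?_⟩
    · simp [twistRightLift_rmk]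
    · simp [twistRightLift_rmk]
    · have := he.1 x m
      simp_all [twistRightLift_rmk, twistRight_lact_rmk]
    · have := fun y => he.2 y m
      simp_all [twistRightLift_rmk, fun M => twistRight_ract_rmk (X := X) ρ M h (ℛ k h)]

end TwistRight

section TwistLeft

variable {W : Type u} [AddCommGroup W] [Module k W] (σ : H →ₐ[k] Module.End k W)

/-- The left action `h · (w ⊗ n) = h₂ w ⊗ h₁ n` on `W ⊗ N`. -/
noncomputable def codiagLact (N : Bimod k H Y) : H →ₐ[k] Module.End k (W ⊗[k] N.carrier) :=
  ((Module.endTensorEndAlgHom (R := k) (S := k) (A := k)).comp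
    (Algebra.TensorProduct.map σ N.lact)).comp
    ((Algebra.TensorProduct.comm k H H).toAlgHom.comp (Bialgebra.comulAlgHom k H))

theorem codiagLact_apply (N : Bimod k H Y) {ι : Type*} (h : H) (r : Coalgebra.Repr k h ι) :
    codiagLact σ N h = ∑ i ∈ r.index,
      TensorProduct.map (σ (r.right i)) (N.lact (r.left i)) := by
  simp only [codiagLact, AlgHom.comp_apply, Bialgebra.comulAlgHom_apply, ← r.eq, map_sum]
  rfl

/-- For a left `H`-module `W`, the bimodule `W ⊗ N` with left action `h · (w ⊗ n) = h₂ w ⊗ h₁ n`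
and right action on `N`. -/
noncomputable def twistLeft (N : Bimod k H Y) : Bimod k H Y where
  carrier := W ⊗[k] N.carrier
  lact := codiagLact σ N
  ract := (Module.endTensorEndAlgHom (R := k) (S := k) (A := k)).comp
    (Algebra.TensorProduct.includeRight.comp N.ract)
  comm h y t := by
    rw [codiagLact_apply σ N h (ℛ k h)]
    simp only [LinearMap.sum_apply, map_sum]
    refine Finset.sum_congr rfl fun i _ => ?_
    induction t using TensorProduct.induction_on with
    | zero => simp
    | add t t' ht ht' => simp only [map_add, ht, ht']
    | tmul m v => simp [Module.endTensorEndAlgHom_apply, N.comm]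

/-- The element `w ⊗ n` of `twistLeft σ N`, as a bilinear map. -/
noncomputable def lmk (N : Bimod k H Y) : W →ₗ[k] N.carrier →ₗ[k] (twistLeft σ N).carrier :=
  TensorProduct.mk k W N.carrier

theorem twistLeft_ract_lmk (N : Bimod k H Y) (y : Yᵐᵒᵖ) (w : W) (n : N.carrier) :
    (twistLeft σ N).ract y (lmk σ N w n) = lmk σ N w (N.ract y n) := rfl

theorem twistLeft_lact_lmk (N : Bimod k H Y) {ι : Type*} (h : H) (r : Coalgebra.Repr k h ι)
    (w : W) (n : N.carrier) : (twistLeft σ N).lact h (lmk σ N w n) =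
      ∑ i ∈ r.index, lmk σ N (σ (r.right i) w) (N.lact (r.left i) n) := by
  change codiagLact σ N h (w ⊗ₜ[k] n) = _
  rw [codiagLact_apply σ N h r, LinearMap.sum_apply]
  rfl

theorem twistLeft_hom_ext {N : Bimod k H Y} {P : Type*} [AddCommGroup P] [Module k P]
    {f g : (twistLeft σ N).carrier →ₗ[k] P} (h : ∀ w n, f (lmk σ N w n) = g (lmk σ N w n)) :
    f = g :=
  TensorProduct.ext' h

/-- The linear map out of `twistLeft σ N` given by a bilinear map. -/
noncomputable def twistLeftLift {N : Bimod k H Y} {P : Type*} [AddCommGroup P] [Module k P]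
    (f : W →ₗ[k] N.carrier →ₗ[k] P) : (twistLeft σ N).carrier →ₗ[k] P :=
  TensorProduct.lift f

theorem twistLeftLift_lmk {N : Bimod k H Y} {P : Type*} [AddCommGroup P] [Module k P]
    (f : W →ₗ[k] N.carrier →ₗ[k] P) (w : W) (n : N.carrier) :
    twistLeftLift σ f (lmk σ N w n) = f w n := rfl

theorem isHom_of_lmk {N P : Bimod k H Y} {f : (twistLeft σ N).carrier →ₗ[k] P.carrier}
    (hl : ∀ h w n, f ((twistLeft σ N).lact h (lmk σ N w n)) = P.lact h (f (lmk σ N w n)))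
    (hr : ∀ y w n, f (lmk σ N w (N.ract y n)) = P.ract y (f (lmk σ N w n))) :
    IsHom (twistLeft σ N) P f :=
  ⟨fun x t => LinearMap.congr_fun (f := f ∘ₗ (twistLeft σ N).lact x) (g := P.lact x ∘ₗ f)
      (twistLeft_hom_ext σ fun m n => hl x m n) t,
    fun y t => LinearMap.congr_fun (f := f ∘ₗ (twistLeft σ N).ract y) (g := P.ract y ∘ₗ f)
      (twistLeft_hom_ext σ fun m n => hr y m n) t⟩

theorem Isom.twistLeft_congr {M N : Bimod k H Y} : Isom M N → Isom (twistLeft σ M) (twistLeft σ N)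
  | ⟨e, he⟩ => by
    refine ⟨LinearEquiv.ofLinearMap (twistLeftLift σ ((lmk σ N).compl₂ e.toLinearMap))
      (twistLeftLift σ ((lmk σ M).compl₂ e.symm.toLinearMap))
      (twistLeft_hom_ext σ fun m v => ?_) (twistLeft_hom_ext σ fun m v => ?_),
      isHom_of_lmk σ (fun h w n => ?_) fun y w n => ?_⟩
    · simp [twistLeftLift_lmk]
    · simp [twistLeftLift_lmk]
    · have := fun x => he.1 x n
      simp_all [twistLeftLift_lmk, fun M => twistLeft_lact_lmk (Y := Y) σ M h (ℛ k h)]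
    · have := he.2 y n
      simp_all [twistLeftLift_lmk, twistLeft_ract_lmk]

/-- `((w ⊗ n), p) ↦ w ⊗ (n ⊗ p)` with values in `W ⊗ (N ⊗_B P)`. -/
noncomputable def twistLeftAssoc {B : Type u} [Ring B] [Algebra k B] (N : Bimod k H B)
    (P : Bimod k B Y) :
    (twistLeft σ N).carrier →ₗ[k] P.carrier →ₗ[k] (twistLeft σ (tensor N P)).carrier :=
  twistLeftLift σ (LinearMap.mk₂ k (fun w n => lmk σ (tensor N P) w ∘ₗ tmk N P n)
    (fun w w' n => by ext; simp) (fun c w n => by ext; simp)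
    (fun w n n' => by ext; simp) (fun c w n => by ext; simp))

/-- `(n, p) ↦ (w ↦ (w ⊗ n) ⊗ p)` with values in `(W ⊗ N) ⊗_B P`. -/
noncomputable def twistLeftAssocInv {B : Type u} [Ring B] [Algebra k B] (N : Bimod k H B)
    (P : Bimod k B Y) :
    N.carrier →ₗ[k] P.carrier →ₗ[k] W →ₗ[k] (tensor (twistLeft σ N) P).carrier :=
  LinearMap.mk₂ k (fun n p => (tmk (twistLeft σ N) P).flip p ∘ₗ (lmk σ N).flip n)
    (fun n n' p => by ext; simp) (fun c n p => by ext; simp)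
    (fun n p p' => by ext; simp) (fun c n p => by ext; simp)

/-- `(W ⊗ N) ⊗_B P ≅ W ⊗ (N ⊗_B P)`. -/
theorem twistLeft_tensor {B : Type u} [Ring B] [Algebra k B] (N : Bimod k H B) (P : Bimod k B Y) :
    Isom (tensor (twistLeft σ N) P) (twistLeft σ (tensor N P)) := by
  have hf : ∀ (t : (twistLeft σ N).carrier) (b : B) (p : P.carrier),
      twistLeftAssoc σ N P ((twistLeft σ N).ract (MulOpposite.op b) t) p =
        twistLeftAssoc σ N P t (P.lact b p) := fun t b p =>
    LinearMap.congr_fun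
      (f := (twistLeftAssoc σ N P).flip p ∘ₗ (twistLeft σ N).ract (MulOpposite.op b))
      (g := (twistLeftAssoc σ N P).flip (P.lact b p))
      (twistLeft_hom_ext σ fun w n => congrArg (lmk σ (tensor N P) w) (tmk_balanced N P n b p)) t
  have hg : ∀ (n : N.carrier) (b : B) (p : P.carrier),
      twistLeftAssocInv σ N P (N.ract (MulOpposite.op b) n) p =
        twistLeftAssocInv σ N P n (P.lact b p) := fun n b p =>
    LinearMap.ext fun w => tmk_balanced (twistLeft σ N) P (lmk σ N w n) b p
  let F : (tensor (twistLeft σ N) P).carrier →ₗ[k] (twistLeft σ (tensor N P)).carrier :=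
    tensorLift (twistLeftAssoc σ N P) hf
  let G : (twistLeft σ (tensor N P)).carrier →ₗ[k] (tensor (twistLeft σ N) P).carrier :=
    twistLeftLift σ (tensorLift (twistLeftAssocInv σ N P) hg).flip
  have hF : ∀ (w : W) (n : N.carrier) (p : P.carrier),
      F (tmk (twistLeft σ N) P (lmk σ N w n) p) = lmk σ (tensor N P) w (tmk N P n p) :=
    fun w n p => tensorLift_tmk _ hf _ _
  have hG : ∀ (w : W) (n : N.carrier) (p : P.carrier),
      G (lmk σ (tensor N P) w (tmk N P n p)) = tmk (twistLeft σ N) P (lmk σ N w n) p :=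
    fun w n p => LinearMap.congr_fun (tensorLift_tmk _ hg n p) w
  have ext_right : ∀ {f g : (twistLeft σ (tensor N P)).carrier →ₗ[k]
      (tensor (twistLeft σ N) P).carrier}, (∀ (w : W) (n : N.carrier) (p : P.carrier),
      f (lmk σ (tensor N P) w (tmk N P n p)) = g (lmk σ (tensor N P) w (tmk N P n p))) → f = g :=
    fun {f g} h => twistLeft_hom_ext σ fun w t => LinearMap.congr_fun
      (f := f ∘ₗ lmk σ (tensor N P) w) (g := g ∘ₗ lmk σ (tensor N P) w)
      (tensor_hom_ext fun n p => h w n p) t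
  have hFG : F ∘ₗ G = LinearMap.id := twistLeft_hom_ext σ fun w t => LinearMap.congr_fun
    (f := (F ∘ₗ G) ∘ₗ lmk σ (tensor N P) w) (g := lmk σ (tensor N P) w)
    (tensor_hom_ext fun n p => (congrArg F (hG w n p)).trans (hF w n p)) t
  have hGF : G ∘ₗ F = LinearMap.id := tensor_hom_ext fun t p => LinearMap.congr_fun
    (f := ((tmk (twistLeft σ N) P).compr₂ (G ∘ₗ F)).flip p) (g := (tmk (twistLeft σ N) P).flip p)
    (twistLeft_hom_ext σ fun w n => (congrArg G (hF w n p)).trans (hG w n p)) t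
  refine Isom.symm ⟨LinearEquiv.ofLinearMap G F hGF hFG, fun h t => ?_, fun y t => ?_⟩
  · refine LinearMap.congr_fun (f := G ∘ₗ (twistLeft σ (tensor N P)).lact h)
      (g := (tensor (twistLeft σ N) P).lact h ∘ₗ G) (ext_right fun w n p => ?_) t
    simp only [LinearMap.comp_apply, hG, tensor_lact_tmk, map_sum, LinearMap.sum_apply,
      twistLeft_lact_lmk σ _ h (ℛ k h)]
  · refine LinearMap.congr_fun (f := G ∘ₗ (twistLeft σ (tensor N P)).ract y)
      (g := (tensor (twistLeft σ N) P).ract y ∘ₗ G) (ext_right fun w n p => ?_) t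
    simp only [LinearMap.comp_apply, hG, tensor_ract_tmk, twistLeft_ract_lmk]

/-- Twisting repeatedly on the left commutes with tensoring on the right. -/
theorem iterate_twistLeft_tensor {B : Type u} [Ring B] [Algebra k B] (N : Bimod k H B)
    (P : Bimod k B Y) (n : ℕ) :
    Isom (tensor ((twistLeft σ)^[n] N) P) ((twistLeft σ)^[n] (tensor N P)) := by
  induction n with
  | zero => exact Isom.refl _
  | succ n ih =>
    rw [Function.iterate_succ_apply', Function.iterate_succ_apply']
    exact (twistLeft_tensor σ _ P).trans (ih.twistLeft_congr σ)

theorem iterate_twistLeft_congr {N P : Bimod k H Y} (h : Isom N P) (n : ℕ) :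
    Isom ((twistLeft σ)^[n] N) ((twistLeft σ)^[n] P) := by
  induction n with
  | zero => exact h
  | succ n ih =>
    rw [Function.iterate_succ_apply', Function.iterate_succ_apply']
    exact ih.twistLeft_congr σ

end TwistLeft

section DualTwist

variable {V W : Type u} [AddCommGroup V] [Module k V] [AddCommGroup W] [Module k W]
  (ρ : Hᵐᵒᵖ →ₐ[k] Module.End k V) (σ : H →ₐ[k] Module.End k W) (ev : W →ₗ[k] V →ₗ[k] k)
  {M : Bimod k X H} {N : Bimod k H X}

/-- The pairing `⟨m ⊗ v, w ⊗ n⟩ = w(v) ⟨m, n⟩`. -/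
noncomputable def twistPair (β : M.carrier →ₗ[k] N.carrier →ₗ[k] X) :
    (twistRight ρ M).carrier →ₗ[k] (twistLeft σ N).carrier →ₗ[k] X :=
  twistRightLift ρ (LinearMap.mk₂ k
    (fun m v => twistLeftLift σ (LinearMap.mk₂ k (fun w n => ev w v • β m n)
      (fun w w' n => by simp [add_smul]) (fun c w n => by simp [mul_smul])
      (fun w n n' => by simp) (fun c w n => by simp [smul_comm c])))
    (fun m m' v => twistLeft_hom_ext σ fun w n => by simp [twistLeftLift_lmk])
    (fun c m v => twistLeft_hom_ext σ fun w n => by simp [twistLeftLift_lmk, smul_comm c])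
    (fun m v v' => twistLeft_hom_ext σ fun w n => by simp [twistLeftLift_lmk, add_smul])
    (fun c m v => twistLeft_hom_ext σ fun w n => by simp [twistLeftLift_lmk, mul_smul]))

theorem twistPair_mk (β : M.carrier →ₗ[k] N.carrier →ₗ[k] X) (m : M.carrier) (v : V) (w : W)
    (n : N.carrier) : twistPair ρ σ ev β (rmk ρ M m v) (lmk σ N w n) = ev w v • β m n := rfl

/-- A duality between `M` and `N` and a pairing of a left `H`-module `W` with a right `H`-module `V`
with finite dual bases give a duality between `M ⊗ V` and `W ⊗ N`. -/
noncomputable def Duality.twist (D : Duality M N)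
    (hev : ∀ h w v, ev (σ h w) v = ev w (ρ (MulOpposite.op h) v))
    {κ : Type} [Fintype κ] (b : κ → V) (c : κ → W)
    (hb : ∀ v, ∑ j, ev (c j) v • b j = v) (hc : ∀ w, ∑ j, ev w (b j) • c j = w) :
    Duality (twistRight ρ M) (twistLeft σ N) := by
  let β := twistPair ρ σ ev D.pair
  have ext₂ : ∀ {f g : (twistRight ρ M).carrier →ₗ[k] (twistLeft σ N).carrier →ₗ[k] X},
      (∀ m v w n, f (rmk ρ M m v) (lmk σ N w n) = g (rmk ρ M m v) (lmk σ N w n)) →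
        ∀ s t, f s t = g s t :=
    fun h s t => LinearMap.congr_fun (LinearMap.congr_fun
      (twistRight_hom_ext ρ fun m v => twistLeft_hom_ext σ fun w n => h m v w n) s) t
  refine
    { pair := β
      pair_lact := fun x => ext₂ (f := β ∘ₗ (twistRight ρ M).lact x)
        (g := β.compr₂ (LinearMap.mulLeft k x)) fun m v w n => ?_
      pair_ract := fun x => ext₂ (f := β.compl₂ ((twistLeft σ N).ract (MulOpposite.op x)))
        (g := β.compr₂ (LinearMap.mulRight k x)) fun m v w n => ?_
      pair_balanced := fun y => ext₂ (f := β ∘ₗ (twistRight ρ M).ract (MulOpposite.op y))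
        (g := β.compl₂ ((twistLeft σ N).lact y)) fun m v w n => ?_
      ι := D.ι × κ
      left := fun i => rmk ρ M (D.left i.1) (b i.2)
      right := fun i => lmk σ N (c i.2) (D.right i.1)
      left_expand := fun s => ?_
      right_expand := fun t => ?_ }
  · simp [β, twistPair_mk, twistRight_lact_rmk, D.pair_lact]
  · simp [β, twistPair_mk, twistLeft_ract_lmk, D.pair_ract]
  · simp [β, twistPair_mk, twistRight_ract_rmk ρ M y (ℛ k y), twistLeft_lact_lmk σ N y (ℛ k y),
      D.pair_balanced, hev]
  · have h := LinearMap.congr_fun (f := ∑ i : D.ι × κ, (twistRight ρ M).lact.toLinearMap.flip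
      (rmk ρ M (D.left i.1) (b i.2)) ∘ₗ β.flip (lmk σ N (c i.2) (D.right i.1)))
      (g := LinearMap.id) (twistRight_hom_ext ρ fun m v => ?_) s
    · simpa using h
    · conv_rhs => rw [LinearMap.id_apply, ← D.left_expand m, ← hb v]
      simp [β, twistPair_mk, twistRight_lact_rmk, Fintype.sum_prod_type_right, Finset.smul_sum]
  · have h := LinearMap.congr_fun (f := ∑ i : D.ι × κ, ractFlip (twistLeft σ N)
      (lmk σ N (c i.2) (D.right i.1)) ∘ₗ β (rmk ρ M (D.left i.1) (b i.2)))
      (g := LinearMap.id) (twistLeft_hom_ext σ fun w n => ?_) t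
    · simpa [ractFlip] using h
    · conv_rhs => rw [LinearMap.id_apply, ← D.right_expand n, ← hc w]
      simp [β, twistPair_mk, twistLeft_ract_lmk, Fintype.sum_prod_type, ractFlip]

end DualTwist

end Bimod

end Twist

/-! ### Tensoring over a Hopf subalgebra -/

section Hopf

open Coalgebra

variable {k : Type u} [Field k] {H : Type u} [Ring H] [HopfAlgebra k H]

/-- `h₁ S(h₂) ⊗ h₃ = 1 ⊗ h`. -/
theorem sum_mul_antipode_tmul (h : H) :
    ∑ i ∈ (ℛ k h).index, ∑ j ∈ (ℛ k ((ℛ k h).right i)).index,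
      ((ℛ k h).left i * HopfAlgebra.antipode k ((ℛ k ((ℛ k h).right i)).left j)) ⊗ₜ[k]
        (ℛ k ((ℛ k h).right i)).right j = 1 ⊗ₜ[k] h := by
  have := congrArg ((LinearMap.mul' k H ∘ₗ (HopfAlgebra.antipode k).lTensor H).rTensor H ∘ₗ
    (TensorProduct.assoc k H H H).symm.toLinearMap)
    (sum_tmul_tmul_eq (ℛ k h) (fun i => ℛ k ((ℛ k h).left i)) (fun i => ℛ k ((ℛ k h).right i)))
  simp only [map_sum, LinearMap.comp_apply, LinearEquiv.coe_coe, TensorProduct.assoc_symm_tmul,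
    LinearMap.rTensor_tmul, LinearMap.lTensor_tmul, LinearMap.mul'_apply] at this
  rw [← this]
  simp only [← TensorProduct.sum_tmul, HopfAlgebra.sum_mul_antipode_eq_smul,
    TensorProduct.smul_tmul, ← TensorProduct.tmul_sum, sum_counit_smul]

/-- `S(h₁) h₂ ⊗ h₃ = 1 ⊗ h`. -/
theorem sum_antipode_mul_tmul (h : H) :
    ∑ i ∈ (ℛ k h).index, ∑ j ∈ (ℛ k ((ℛ k h).right i)).index,
      (HopfAlgebra.antipode k ((ℛ k h).left i) * (ℛ k ((ℛ k h).right i)).left j) ⊗ₜ[k]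
        (ℛ k ((ℛ k h).right i)).right j = 1 ⊗ₜ[k] h := by
  have := congrArg ((LinearMap.mul' k H ∘ₗ (HopfAlgebra.antipode k).rTensor H).rTensor H ∘ₗ
    (TensorProduct.assoc k H H H).symm.toLinearMap)
    (sum_tmul_tmul_eq (ℛ k h) (fun i => ℛ k ((ℛ k h).left i)) (fun i => ℛ k ((ℛ k h).right i)))
  simp only [map_sum, LinearMap.comp_apply, LinearEquiv.coe_coe, TensorProduct.assoc_symm_tmul,
    LinearMap.rTensor_tmul, LinearMap.mul'_apply] at this
  rw [← this]
  simp only [← TensorProduct.sum_tmul, HopfAlgebra.sum_antipode_mul_eq_smul,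
    TensorProduct.smul_tmul, ← TensorProduct.tmul_sum, sum_counit_smul]

theorem sum_mul_antipode_apply {P : Type*} [AddCommGroup P] [Module k P] (φ : H →ₗ[k] H →ₗ[k] P)
    (h : H) : ∑ i ∈ (ℛ k h).index, ∑ j ∈ (ℛ k ((ℛ k h).right i)).index,
      φ ((ℛ k h).left i * HopfAlgebra.antipode k ((ℛ k ((ℛ k h).right i)).left j))
        ((ℛ k ((ℛ k h).right i)).right j) = φ 1 h := by
  have := congrArg (TensorProduct.lift φ) (sum_mul_antipode_tmul h)
  simpa only [map_sum, TensorProduct.lift.tmul] using this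

theorem sum_antipode_mul_apply {P : Type*} [AddCommGroup P] [Module k P] (φ : H →ₗ[k] H →ₗ[k] P)
    (h : H) : ∑ i ∈ (ℛ k h).index, ∑ j ∈ (ℛ k ((ℛ k h).right i)).index,
      φ (HopfAlgebra.antipode k ((ℛ k h).left i) * (ℛ k ((ℛ k h).right i)).left j)
        ((ℛ k ((ℛ k h).right i)).right j) = φ 1 h := by
  have := congrArg (TensorProduct.lift φ) (sum_antipode_mul_tmul h)
  simpa only [map_sum, TensorProduct.lift.tmul] using this

namespace HopfSubalgebra

variable (R : HopfSubalgebra k H)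

/-- The coproduct of an element of a Hopf subalgebra has a representative in the subalgebra. -/
theorem exists_repr (r : H) (hr : r ∈ R.toSubalgebra) :
    ∃ (n : ℕ) (c : Coalgebra.Repr k r (Fin n)),
      (∀ i, c.left i ∈ R.toSubalgebra) ∧ ∀ i, c.right i ∈ R.toSubalgebra := by
  obtain ⟨t, ht⟩ := R.comul_mem r hr
  obtain ⟨n, a, b, rfl⟩ := TensorProduct.exists_sum_tmul_eq t
  exact ⟨n, ⟨Finset.univ, fun i => a i, fun i => b i, by simpa using ht⟩,
    fun i => (a i).2, fun i => (b i).2⟩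

/-- The right action of `H` on `Q`, as an algebra homomorphism. -/
def rightMulHom : Hᵐᵒᵖ →ₐ[k] Module.End k R.Q :=
  AlgHom.ofLinearMap
    { toFun := fun h => R.rightMul h.unop
      map_add' := fun _ _ => R.rightMul_add _ _
      map_smul' := fun _ _ => R.rightMul_smul _ _ }
    R.rightMul_one (fun _ _ => R.rightMul_mul _ _)

theorem rightMulHom_op_mkQ (h x : H) :
    R.rightMulHom (MulOpposite.op h) (R.augIdeal.mkQ x) = R.augIdeal.mkQ (x * h) := rfl

variable {X : Type u} [Ring X] [Algebra k X] (M : Bimod k X H)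

/-- The bimodule `M ⊗_R H`. -/
abbrev extend : Bimod k X H :=
  Bimod.tensor (M.restrict (AlgHom.id k X) R.toSubalgebra.val)
    ((Bimod.regular k H).restrict R.toSubalgebra.val (AlgHom.id k H))

/-- The class of `m ⊗ h` in `M ⊗_R H`, as a bilinear map. -/
def emk : M.carrier →ₗ[k] H →ₗ[k] (R.extend M).carrier :=
  Bimod.tmk (M.restrict (AlgHom.id k X) R.toSubalgebra.val)
    ((Bimod.regular k H).restrict R.toSubalgebra.val (AlgHom.id k H))

theorem emk_balanced (m : M.carrier) (r : H) (hr : r ∈ R.toSubalgebra) (h : H) :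
    R.emk M (M.ract (MulOpposite.op r) m) h = R.emk M m (r * h) :=
  Bimod.tmk_balanced (M.restrict (AlgHom.id k X) R.toSubalgebra.val)
    ((Bimod.regular k H).restrict R.toSubalgebra.val (AlgHom.id k H)) m ⟨r, hr⟩ h

theorem extend_hom_ext {P : Type*} [AddCommGroup P] [Module k P]
    {f g : (R.extend M).carrier →ₗ[k] P} (h : ∀ m x, f (R.emk M m x) = g (R.emk M m x)) : f = g :=
  Bimod.tensor_hom_ext h

/-- The linear map out of `M ⊗_R H` given by an `R`-balanced bilinear map. -/
def extendLift {P : Type*} [AddCommGroup P] [Module k P] (f : M.carrier →ₗ[k] H →ₗ[k] P)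
    (hf : ∀ m, ∀ r ∈ R.toSubalgebra, ∀ h, f (M.ract (MulOpposite.op r) m) h = f m (r * h)) :
    (R.extend M).carrier →ₗ[k] P :=
  Bimod.tensorLift (M := M.restrict (AlgHom.id k X) R.toSubalgebra.val)
    (N := (Bimod.regular k H).restrict R.toSubalgebra.val (AlgHom.id k H)) f
    fun m b n => hf m b b.2 n

theorem extendLift_emk {P : Type*} [AddCommGroup P] [Module k P] (f : M.carrier →ₗ[k] H →ₗ[k] P)
    (hf : ∀ m, ∀ r ∈ R.toSubalgebra, ∀ h, f (M.ract (MulOpposite.op r) m) h = f m (r * h))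
    (m : M.carrier) (h : H) : R.extendLift M f hf (R.emk M m h) = f m h := rfl

/-- The bilinear map `(m, h) ↦ m h₁ ⊗ h₂` with values in `M ⊗ Q`. -/
noncomputable def toTwist : M.carrier →ₗ[k] H →ₗ[k] (Bimod.twistRight R.rightMulHom M).carrier :=
  (TensorProduct.lift (LinearMap.mk₂ k
    (fun a b => (Bimod.rmk R.rightMulHom M).flip (R.augIdeal.mkQ b) ∘ₗ M.ract (MulOpposite.op a))
    (fun a a' b => by ext; simp) (fun c a b => by ext; simp)
    (fun a b b' => by ext; simp) (fun c a b => by ext; simp)) ∘ₗ comul).flip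

theorem toTwist_apply (m : M.carrier) (h : H) {ι : Type*} (c : Coalgebra.Repr k h ι) :
    R.toTwist M m h = ∑ i ∈ c.index, Bimod.rmk R.rightMulHom M
      (M.ract (MulOpposite.op (c.left i)) m) (R.augIdeal.mkQ (c.right i)) := by
  simp [toTwist, ← c.eq]

theorem toTwist_balanced (m : M.carrier) (r : H) (hr : r ∈ R.toSubalgebra) (h : H) :
    R.toTwist M (M.ract (MulOpposite.op r) m) h = R.toTwist M m (r * h) := by
  obtain ⟨n, c, hl, hr⟩ := R.exists_repr r hr
  rw [R.toTwist_apply M _ h (ℛ k h), R.toTwist_apply M m _ (c.mul (ℛ k h))]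
  -- `r = r₁ ε(r₂)`, and `ε(r₂)` is absorbed by the class of `r₂ h₂` in `Q`.
  have h1 : ∑ i ∈ c.index, counit (R := k) (c.right i) • c.left i = r := by
    have := congrArg (TensorProduct.rid k H) (sum_tmul_counit_eq c)
    simpa only [map_sum, TensorProduct.rid_tmul, one_smul] using this
  conv_lhs => rw [← h1]
  simp [Coalgebra.Repr.mul_index, Coalgebra.Repr.mul_left, Coalgebra.Repr.mul_right,
    Finset.sum_product_right, R.mk_mul_eq _ (hr _), MulOpposite.op_mul, Finset.op_sum]

/-- The bilinear map `(h, m) ↦ m S(h₁) ⊗ h₂` with values in `M ⊗_R H`. -/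
noncomputable def ofTwistAux : H →ₗ[k] M.carrier →ₗ[k] (R.extend M).carrier :=
  TensorProduct.lift (LinearMap.mk₂ k
    (fun a b => (R.emk M).flip b ∘ₗ M.ract (MulOpposite.op (HopfAlgebra.antipode k a)))
    (fun a a' b => by ext; simp) (fun c a b => by ext; simp)
    (fun a b b' => by ext; simp) (fun c a b => by ext; simp)) ∘ₗ comul

theorem ofTwistAux_apply (m : M.carrier) (h : H) {ι : Type*} (c : Coalgebra.Repr k h ι) :
    R.ofTwistAux M h m = ∑ i ∈ c.index, R.emk M
      (M.ract (MulOpposite.op (HopfAlgebra.antipode k (c.left i))) m) (c.right i) := by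
  simp [ofTwistAux, ← c.eq]

/-- The kernel `R⁺ H` of `H → Q` acts by zero, as `S(r₁ h₁) r₂ = S(h₁) S(r₁) r₂`. -/
theorem ofTwistAux_mul (m : M.carrier) (r : H) (hr : r ∈ R.toSubalgebra) (h : H) :
    R.ofTwistAux M (r * h) m = counit (R := k) r • R.ofTwistAux M h m := by
  obtain ⟨n, c, hl, hr⟩ := R.exists_repr r hr
  rw [R.ofTwistAux_apply M m h (ℛ k h), R.ofTwistAux_apply M m _ (c.mul (ℛ k h))]
  simp only [Coalgebra.Repr.mul_index, Coalgebra.Repr.mul_left, Coalgebra.Repr.mul_right,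
    Finset.sum_product_right, HopfAlgebra.antipode_mul_antidistrib, ← R.emk_balanced M _ _ (hr _),
    Finset.smul_sum]
  refine Finset.sum_congr rfl fun i _ => ?_
  have h1 := congrArg (fun z => R.emk M (M.ract (MulOpposite.op z)
    (M.ract (MulOpposite.op (HopfAlgebra.antipode k ((ℛ k h).left i))) m)) ((ℛ k h).right i))
    (HopfAlgebra.sum_antipode_mul_eq_smul c)
  simpa [MulOpposite.op_mul, Finset.op_sum] using h1

/-- The linear map `m ⊗ h ↦ m S(h₁) ⊗ h₂` from `M ⊗ Q` to `M ⊗_R H`. -/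
noncomputable def ofTwist : (Bimod.twistRight R.rightMulHom M).carrier →ₗ[k] (R.extend M).carrier :=
  Bimod.twistRightLift R.rightMulHom (R.augIdeal.liftQ (R.ofTwistAux M) (by
    refine Submodule.span_le.2 ?_
    rintro _ ⟨r, hr, h0, h, rfl⟩
    refine LinearMap.ext fun m => ?_
    rw [R.ofTwistAux_mul M m r hr, h0, zero_smul]
    rfl)).flip

theorem ofTwist_rmk (m : M.carrier) (h : H) :
    R.ofTwist M (Bimod.rmk R.rightMulHom M m (R.augIdeal.mkQ h)) = R.ofTwistAux M h m := rfl

/-- `M ⊗_R H ≅ M ⊗ Q`, where `H` acts diagonally from the right on `M ⊗ Q`. -/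
theorem extend_isom : Bimod.Isom (R.extend M) (Bimod.twistRight R.rightMulHom M) := by
  refine ⟨LinearEquiv.ofLinearMap (R.extendLift M (R.toTwist M) (R.toTwist_balanced M))
    (R.ofTwist M) (Bimod.twistRight_hom_ext _ fun m v => ?_) (R.extend_hom_ext M fun m h => ?_),
    Bimod.isHom_of_tmk (fun x (m : M.carrier) (h : H) => ?_) fun y (m : M.carrier) (h : H) => ?_⟩
  · obtain ⟨h, rfl⟩ := R.augIdeal.mkQ_surjective v
    have h1 := sum_antipode_mul_apply (k := k)
      ((Bimod.rmk R.rightMulHom M).compl₁₂ (Bimod.ractFlip M m) R.augIdeal.mkQ) h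
    simp only [LinearMap.compl₁₂_apply, Bimod.ractFlip_apply, MulOpposite.op_mul, map_mul,
      MulOpposite.op_one, map_one, Module.End.mul_apply, Module.End.one_apply] at h1
    rw [LinearMap.comp_apply, R.ofTwist_rmk, R.ofTwistAux_apply M m h (ℛ k h), map_sum,
      LinearMap.id_apply, ← h1]
    exact Finset.sum_congr rfl fun i _ => R.toTwist_apply M _ _ (ℛ k _)
  · have h1 := sum_mul_antipode_apply (k := k)
      ((R.emk M).comp (Bimod.ractFlip M m)) h
    simp only [LinearMap.comp_apply, Bimod.ractFlip_apply, MulOpposite.op_mul, map_mul,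
      MulOpposite.op_one, map_one, Module.End.mul_apply, Module.End.one_apply] at h1
    rw [LinearMap.comp_apply, R.extendLift_emk, R.toTwist_apply M m h (ℛ k h), map_sum,
      LinearMap.id_apply, ← h1]
    exact Finset.sum_congr rfl fun i _ => R.ofTwistAux_apply M _ _ (ℛ k _)
  · change R.toTwist M (M.lact x m) h =
      (Bimod.twistRight R.rightMulHom M).lact x (R.toTwist M m h)
    simp only [R.toTwist_apply M _ h (ℛ k h), map_sum, Bimod.twistRight_lact_rmk, M.comm]
  · induction y using MulOpposite.rec' with | _ g => ?_
    change R.toTwist M m (h * g) =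
      (Bimod.twistRight R.rightMulHom M).ract (MulOpposite.op g) (R.toTwist M m h)
    rw [R.toTwist_apply M m _ ((ℛ k h).mul (ℛ k g)), R.toTwist_apply M m h (ℛ k h), map_sum]
    simp only [Bimod.twistRight_ract_rmk _ M g (ℛ k g), R.rightMulHom_op_mkQ,
      Coalgebra.Repr.mul_index, Coalgebra.Repr.mul_left, Coalgebra.Repr.mul_right,
      Finset.sum_product, MulOpposite.op_mul, map_mul, Module.End.mul_apply]

/-- The `(n + 1)`-st tensor power of `H` over `R` is the `n`-fold twist of `H` by `Q`. -/
theorem tensorPowerSucc_isom (n : ℕ) :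
    Bimod.Isom (tensorPowerSucc R.toSubalgebra.val n)
      ((Bimod.twistRight R.rightMulHom)^[n] (Bimod.regular k H)) := by
  induction n with
  | zero => exact Bimod.Isom.refl _
  | succ n ih =>
    rw [Function.iterate_succ_apply']
    exact (R.extend_isom _).trans (ih.twistRight_congr _)

end HopfSubalgebra

end Hopf

/-! ### Tensor powers of the smash product -/

section SmashPowers

open Coalgebra HopfDepth.Bimod

variable {k : Type u} [Field k] {H : Type u} [Ring H] [HopfAlgebra k H]
  {A : Type u} [Ring A] [Algebra k A] (M : CopAction k H A)

namespace CopAction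

theorem smashMul_tmul_one_tmul (a : A) (g h : H) :
    M.smashMul ((a ⊗ₜ[k] g) ⊗ₜ[k] (1 ⊗ₜ[k] h)) = a ⊗ₜ[k] (g * h) := by
  refine (M.smashMul_tmul a 1 g h (ℛ k g)).trans ?_
  simp only [M.act_one, mul_smul_comm, mul_one, TensorProduct.smul_tmul]
  rw [← TensorProduct.tmul_sum]
  simp only [← smul_mul_assoc, ← Finset.sum_mul]
  have := congrArg (TensorProduct.rid k H) (Coalgebra.sum_tmul_counit_eq (ℛ k g))
  simp only [map_sum, TensorProduct.rid_tmul, one_smul] at this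
  rw [this]

/-- As an `H`-`H`-bimodule, the smash product `A # H` is the twist of `H` by the module `A`. -/
theorem isom_regular_restrict :
    Isom ((regular k M.SmashProduct).restrict M.inclusion M.inclusion)
      (twistLeft M.act (regular k H)) := by
  refine Isom.symm ⟨LinearEquiv.refl k (A ⊗[k] H), isHom_of_lmk M.act (fun h a g => ?_)
    fun y a g => ?_⟩
  · refine (twistLeft_lact_lmk M.act (regular k H) h (ℛ k h) a g).trans
      (Eq.trans ?_ (M.smashMul_tmul 1 a h g (ℛ k h)).symm)
    simp only [one_mul]
    rfl
  · exact (M.smashMul_tmul_one_tmul a g y.unop).symm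

/-- The `n`-th tensor power of `A # H` over `H` is the `n`-fold twist of `H` by `A`. -/
theorem tensorPowerRestricted_isom (n : ℕ) :
    Isom (tensorPowerRestricted M.inclusion n) ((twistLeft M.act)^[n] (regular k H)) := by
  induction n with
  | zero => exact Isom.refl _
  | succ n ih =>
    cases n with
    | zero => exact M.isom_regular_restrict
    | succ n =>
      have h1 : Isom (tensorPowerRestricted M.inclusion (n + 2))
          (tensor (tensorPowerRestricted M.inclusion (n + 1))
            ((regular k M.SmashProduct).restrict M.inclusion M.inclusion)) :=
        ⟨LinearEquiv.refl k _, fun _ _ => rfl, fun _ _ => rfl⟩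
      refine h1.trans ((ih.tensor M.isom_regular_restrict).trans
        ((iterate_twistLeft_tensor M.act _ _ _).trans ?_))
      rw [Function.iterate_succ_apply _ (n + 1)]
      exact iterate_twistLeft_congr M.act (regular_tensor _) _

end CopAction

end SmashPowers

/-! ### Comparison of depths -/

section Comparison

variable {k : Type u} [Field k] {H : Type u} [Ring H] [HopfAlgebra k H]

namespace HopfSubalgebra

variable (R : HopfSubalgebra k H)

/-- The evaluation pairing between `Q^{*op}` and `Q`. -/
def evalQ : R.QDualOp →ₗ[k] R.Q →ₗ[k] k where
  toFun θ := θ.unop.ofConv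
  map_add' _ _ := rfl
  map_smul' _ _ := rfl

/-- The `n`-fold twists of `H` by `Q` and by `Q^{*op}` are dual. -/
theorem nonempty_duality [Module.Finite k H] (n : ℕ) :
    Nonempty (Bimod.Duality ((Bimod.twistRight R.rightMulHom)^[n] (Bimod.regular k H))
      ((Bimod.twistLeft R.copAction.act)^[n] (Bimod.regular k H))) := by
  induction n with
  | zero => exact ⟨Bimod.Duality.regular k H⟩
  | succ n ih =>
    obtain ⟨D⟩ := ih
    rw [Function.iterate_succ_apply', Function.iterate_succ_apply']
    let b := Module.finBasis k R.Q
    refine ⟨D.twist R.rightMulHom R.copAction.act R.evalQ (fun _ _ _ => rfl) b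
      (fun j => MulOpposite.op (WithConv.toConv (b.coord j))) (fun v => b.sum_repr v)
      fun θ => R.qDualOp_ext fun v => ?_⟩
    refine (LinearMap.congr_fun (map_sum R.evalQ _ _) v).trans ?_
    have h : ∑ j, b.repr v j • R.evalQ θ (b j) = R.evalQ θ v := by
      conv_rhs => rw [← b.sum_repr v]
      simp only [map_sum, map_smul]
    refine Eq.trans ?_ h
    rw [LinearMap.sum_apply]
    exact Finset.sum_congr rfl fun j _ => mul_comm _ _

/-- The `n`-th and `(n + 1)`-st powers of the smash product over `H` are similar if and only if the
`(n + 1)`-st and `(n + 2)`-nd powers of `H` over `R` are: `tensorPowerSucc _ n` has `n + 1`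
factors. -/
theorem similar_iff [Module.Finite k H] (n : ℕ) :
    Bimod.Similar (tensorPowerRestricted R.copAction.inclusion n)
        (tensorPowerRestricted R.copAction.inclusion (n + 1)) ↔
      Bimod.Similar (tensorPowerSucc R.toSubalgebra.val n)
        (tensorPowerSucc R.toSubalgebra.val (n + 1)) := by
  obtain ⟨D⟩ := R.nonempty_duality n
  obtain ⟨D'⟩ := R.nonempty_duality (n + 1)
  rw [Bimod.similar_congr (R.copAction.tensorPowerRestricted_isom n)
    (R.copAction.tensorPowerRestricted_isom (n + 1)),
    Bimod.similar_congr (R.tensorPowerSucc_isom n) (R.tensorPowerSucc_isom (n + 1))]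
  exact (D.similar_iff D').symm

end HopfSubalgebra

end Comparison

end HopfDepth

theorem theorem3p11 (k : Type u) [Field k] [CharZero k] (H : Type u) [Ring H] [HopfAlgebra k H]
    [Module.Finite k H] (R : HopfDepth.HopfSubalgebra k H) :
    HopfDepth.oddDepth (R.copAction.inclusion : H →ₐ[k] R.GenSmash) =
      HopfDepth.hDepth (R.toSubalgebra.val : R.toSubalgebra →ₐ[k] H) := by
  refine le_antisymm ?_ ?_
  · refine le_iInf fun n => le_iInf fun hn => le_iInf fun h => ?_
    obtain ⟨n, rfl⟩ := Nat.exists_eq_add_of_le' hn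
    exact iInf₂_le_of_le n ((R.similar_iff n).2 h) le_rfl
  · refine le_iInf fun n => le_iInf fun h => ?_
    exact iInf_le_of_le (n + 1)
      (iInf₂_le_of_le (Nat.le_add_left 1 n) ((R.similar_iff n).1 h) le_rfl)
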